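/- Let $K$ be an abstract simplicial complex. A discrete vector field on $K$ is a non-empty set $W$ of pairs $(\sigma,\tau)$ of simplices of $K$ with $\sigma\subseteq\tau$, $\dim\tau=\dim\sigma+1$, such that each simplex of $K$ lies in at most one pair. It is a gradient vector field if there is no closed path $\alpha_0,\beta_0,\alpha_1,\dots,\beta_{k-1},\alpha_k=\alpha_0$ with $k\ge 1$, $(\alpha_i,\beta_i)\in W$, and $\alpha_{i+1}\ne\alpha_i$ a face of $\beta_i$ with $\dim\alpha_{i+1}=\dim\alpha_i$. The complex of discrete Morse matchings $\mathcal M(K)$ is the simplicial complex whose vertices are the pairs $(\sigma,\tau)$ as above and whose simplices are the gradient vector fields on $K$. For a subcomplex $K\subseteq L$, $\mathcal M(K)$ is a subcomplex of $\mathcal M(L)$. Complexes are identified with their geometric realizations. $\tilde H_k(X;G)$, $k\in\mathbb Z$, is the homology of the augmented singular chain complex (so $\tilde H_{-1}(\emptyset;G)=G$), and $\tilde H_k(X,A;G)$ is the homology of the quotient of the augmented singular chain complexes of $X$ and $A$. By convention $X/\emptyset=X\sqcup\{*\}$. **(A)** Let $K$ be a finite, non-empty simplicial complex, let $CK=v*K$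 be its cone (with $v$ not a vertex of $K$), and let $i\colon\mathcal M(K)\hookrightarrow\mathcal M(CK)$ be the inclusion. Then: 1. For every abelian group $G$ and all $k\in\mathbb Z$, the map $i_*\colon\tilde H_k(\mathcal M(K);G)\to\tilde H_k(\mathcal M(CK);G)$ is zero. 2. There is a homotopy equivalence $$\mathcal M(CK)/\mathcal M(K)\simeq\mathcal M(CK)\vee\Sigma\mathcal M(K),$$ where the wedge may be taken at any point of $\mathcal M(CK)$. Here $\Sigma$ may be the unreduced suspension, with a pole as base point (for $\mathcal M(K)=\emptyset$ it consists of the two poles), and, if $\mathcal M(K)\neq\emptyset$, it may also be the reduced suspension at any base point of $\mathcal M(K)$. Moreover, for every abelian group $G$ and all $k\in\mathbb Z$, $$\tilde H_k(\mathcal M(CK),\mathcal M(K);G)\cong\tilde H_k(\mathcal M(CK);G)\oplus\tilde H_{k-1}(\mathcal M(K);G).$$ 3. For every abelian group $G$, the long exact sequence of the pair $(\mathcal M(CK),\mathcal M(K))$ in reduced homology breaks up into short exact sequences $$0\to\tilde H_k(\mathcal M(CK);G)\to\tilde H_k(\mathcal M(CK),\mathcal M(K);G)\xrightarrow{\ \partial\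 }\tilde H_{k-1}(\mathcal M(K);G)\to0,\qquad k\in\mathbb Z,$$ and each of these splits. **(B)** Let $n\ge2$, let $\Delta^n$ be the simplex on $n+1$ vertices and $\Delta^{n-1}$ one of its facets. Then the inclusion $\mathcal M(\Delta^{n-1})\hookrightarrow\mathcal M(\Delta^n)$ is null-homotopic, for every abelian group $G$ the long exact sequence of the pair $(\mathcal M(\Delta^n),\mathcal M(\Delta^{n-1}))$ breaks up into split short exact sequences as in 3, and for all $k\in\mathbb Z$ $$\tilde H_k(\mathcal M(\Delta^n),\mathcal M(\Delta^{n-1});G)\cong\tilde H_k(\mathcal M(\Delta^n);G)\oplus\tilde H_{k-1}(\mathcal M(\Delta^{n-1});G).$$ -/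

import Mathlib

open CategoryTheory

universe u

/-! ## Simplicial complexes -/

namespace MorseMatching

/-- The cone `v * K`: its simplices are those of `K`, the apex `v`, and the joins of `v` with the
simplices of `K`. It is used for `v` not a vertex of `K`. -/
def cone {V : Type u} [DecidableEq V] (v : V) (K : PreAbstractSimplicialComplex V) :
    PreAbstractSimplicialComplex V where
  faces := {s | s ∈ K.faces ∨ s = {v} ∨ ∃ t ∈ K.faces, s = insert v t}
  isRelLowerSet_faces := by
    rintro s hs
    have key : ∀ t ∈ K.faces, ∀ r ⊆ insert v t, r.Nonempty →
        (r ∈ K.faces ∨ r = {v} ∨ ∃ t ∈ K.faces, r = insert v t) := by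
      intro t ht r hr hne
      by_cases hv : v ∈ r
      · by_cases he : (r.erase v).Nonempty
        · refine Or.inr (Or.inr ⟨r.erase v, (K.isRelLowerSet_faces ht).2 ?_ he, ?_⟩)
          · exact Finset.subset_insert_iff.mp hr
          · rw [Finset.insert_erase hv]
        · refine Or.inr (Or.inl ?_)
          rw [Finset.not_nonempty_iff_eq_empty] at he
          rw [← Finset.insert_erase hv, he]
          rfl
      · exact Or.inl ((K.isRelLowerSet_faces ht).2
          ((Finset.subset_insert_iff_of_notMem hv).mp hr) hne)
    rcases hs with hs | rfl | ⟨t, ht, rfl⟩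
    · exact ⟨(K.isRelLowerSet_faces hs).1,
        fun r hr hne => Or.inl ((K.isRelLowerSet_faces hs).2 hr hne)⟩
    · refine ⟨Finset.singleton_nonempty v, fun r hr hne => Or.inr (Or.inl ?_)⟩
      exact (Finset.subset_singleton_iff.mp hr).resolve_left hne.ne_empty
    · exact ⟨Finset.insert_nonempty v t, fun r hr hne => key t ht r hr hne⟩

theorem le_cone {V : Type u} [DecidableEq V] (v : V) (K : PreAbstractSimplicialComplex V) :
    K ≤ cone v K := fun _ hs => Or.inl hs

/-- The full simplex with vertex set `S`: the simplices are all non-empty subsets of `S`. It is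
`Δⁿ` if `S` has `n + 1` elements. -/
def fullSimplex {V : Type u} (S : Finset V) : PreAbstractSimplicialComplex V where
  faces := {s | s.Nonempty ∧ s ⊆ S}
  isRelLowerSet_faces := fun _ hs => ⟨hs.1, fun _ hr hne => ⟨hne, hr.trans hs.2⟩⟩

theorem fullSimplex_erase_le {V : Type u} [DecidableEq V] (S : Finset V) (v : V) :
    fullSimplex (S.erase v) ≤ fullSimplex S :=
  fun _ hs => ⟨hs.1, hs.2.trans (Finset.erase_subset v S)⟩

/-! ## The complex of discrete Morse matchings -/

/-- `W` is a discrete vector field on `K`: a non-empty set of pairs `(σ, τ)` of simplices of `K`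
with `σ ⊆ τ` and `dim τ = dim σ + 1`, such that every simplex lies in at most one pair. -/
structure IsDiscreteVectorField {V : Type u} (K : PreAbstractSimplicialComplex V)
    (W : Finset (Finset V × Finset V)) : Prop where
  nonempty : W.Nonempty
  fst_mem : ∀ p ∈ W, p.1 ∈ K.faces
  snd_mem : ∀ p ∈ W, p.2 ∈ K.faces
  subset : ∀ p ∈ W, p.1 ⊆ p.2
  card_eq : ∀ p ∈ W, p.2.card = p.1.card + 1
  disjoint : ∀ p ∈ W, ∀ q ∈ W, p ≠ q → p.1 ≠ q.1 ∧ p.1 ≠ q.2 ∧ p.2 ≠ q.1 ∧ p.2 ≠ q.2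

/-- One step `α, β, α'` of a gradient path of `W`: `(α, β) ∈ W`, and `α' ≠ α` is a face of `β` of
the same dimension as `α`. -/
def GradientStep {V : Type u} (W : Finset (Finset V × Finset V)) (α α' : Finset V) : Prop :=
  ∃ β, (α, β) ∈ W ∧ α' ⊆ β ∧ α'.card = α.card ∧ α' ≠ α

/-- `W` is a gradient vector field (an acyclic matching) on `K`: a discrete vector field without
non-trivial closed gradient paths. -/
structure IsGradientVectorField {V : Type u} (K : PreAbstractSimplicialComplex V)
    (W : Finset (Finset V × Finset V)) : Prop extends IsDiscreteVectorField K W where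
  acyclic : ∀ α, ¬ Relation.TransGen (GradientStep W) α α

/-- The complex `M(K)` of discrete Morse matchings: its vertices are the pairs `(σ, τ)`, its
simplices the (non-empty) gradient vector fields on `K`. -/
def matchingComplex {V : Type u} (K : PreAbstractSimplicialComplex V) :
    PreAbstractSimplicialComplex (Finset V × Finset V) where
  faces := {W | IsGradientVectorField K W}
  isRelLowerSet_faces := by
    intro W hW
    refine ⟨hW.nonempty, fun W' hsub hne => ?_⟩
    refine ⟨⟨hne, fun p hp => hW.fst_mem p (hsub hp), fun p hp => hW.snd_mem p (hsub hp),
      fun p hp => hW.subset p (hsub hp), fun p hp => hW.card_eq p (hsub hp),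
      fun p hp q hq => hW.disjoint p (hsub hp) q (hsub hq)⟩, fun α hα => hW.acyclic α ?_⟩
    exact hα.lift id fun _ _ ⟨β, hβ, h⟩ => ⟨β, hsub hβ, h⟩

theorem matchingComplex_mono {V : Type u} {K L : PreAbstractSimplicialComplex V} (h : K ≤ L) :
    matchingComplex K ≤ matchingComplex L := fun _ hW =>
  ⟨⟨hW.nonempty, fun p hp => h (hW.fst_mem p hp), fun p hp => h (hW.snd_mem p hp),
    hW.subset, hW.card_eq, hW.disjoint⟩, hW.acyclic⟩

/-! ## Geometric realization -/

/-- The geometric realization of a finite simplicial complex, in barycentric coordinates, with the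
topology of coordinatewise convergence. -/
def Realization {V : Type u} (X : PreAbstractSimplicialComplex V) : Type u :=
  {x : V → ℝ // ∃ s ∈ X.faces, (∀ a ∈ s, 0 ≤ x a) ∧ (∀ a, a ∉ s → x a = 0) ∧ ∑ a ∈ s, x a = 1}

instance {V : Type u} (X : PreAbstractSimplicialComplex V) : TopologicalSpace (Realization X) :=
  inferInstanceAs (TopologicalSpace {_x : V → ℝ // _})

/-- The inclusion `|X| → |Y|` of realizations, for a subcomplex `X` of `Y`. -/
def realizationIncl {V : Type u} {X Y : PreAbstractSimplicialComplex V} (h : X ≤ Y) :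
    C(Realization X, Realization Y) where
  toFun x := ⟨x.1, x.2.imp fun _ hs => ⟨h hs.1, hs.2⟩⟩
  continuous_toFun := continuous_subtype_val.subtype_mk _

theorem realizationIncl_injective {V : Type u} {X Y : PreAbstractSimplicialComplex V} (h : X ≤ Y) :
    Function.Injective (realizationIncl h) :=
  fun _ _ hxy => Subtype.ext (congrArg (fun z : Realization Y => z.1) hxy)

/-- The space `|M(K)|`. -/
abbrev MorseSpace {V : Type u} (K : PreAbstractSimplicialComplex V) : Type u :=
  Realization (matchingComplex K)

/-- The inclusion `|M(K)| → |M(L)|` induced by a subcomplex `K` of `L`. -/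
abbrev morseIncl {V : Type u} {K L : PreAbstractSimplicialComplex V} (h : K ≤ L) :
    C(MorseSpace K, MorseSpace L) :=
  realizationIncl (matchingComplex_mono h)

/-! ## Quotients, wedges and suspensions -/

/-- The relation on `X ⊔ {*}` that identifies every point of `A` with `*`. -/
inductive CollapseRel {X : Type u} (A : Set X) : X ⊕ Unit → X ⊕ Unit → Prop
  | collapse (a : X) (ha : a ∈ A) : CollapseRel A (Sum.inl a) (Sum.inr ())

/-- The quotient space `X / A`, with the usual convention `X / ∅ = X ⊔ {*}`. -/
def Collapse (X : Type u) [TopologicalSpace X] (A : Set X) : Type u := Quot (CollapseRel A)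

instance (X : Type u) [TopologicalSpace X] (A : Set X) : TopologicalSpace (Collapse X A) :=
  inferInstanceAs (TopologicalSpace (Quot (CollapseRel A)))

/-- The base point of `X / A`, the class of `A`. -/
def Collapse.base {X : Type u} [TopologicalSpace X] (A : Set X) : Collapse X A :=
  Quot.mk _ (Sum.inr ())

/-- The relation on `X ⊔ Y` that identifies `x₀` with `y₀`. -/
inductive WedgeRel {X Y : Type u} (x₀ : X) (y₀ : Y) : X ⊕ Y → X ⊕ Y → Prop
  | glue : WedgeRel x₀ y₀ (Sum.inl x₀) (Sum.inr y₀)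

/-- The wedge `X ∨ Y` at the base points `x₀` and `y₀`. -/
def Wedge (X Y : Type u) [TopologicalSpace X] [TopologicalSpace Y] (x₀ : X) (y₀ : Y) : Type u :=
  Quot (WedgeRel x₀ y₀)

instance (X Y : Type u) [TopologicalSpace X] [TopologicalSpace Y] (x₀ : X) (y₀ : Y) :
    TopologicalSpace (Wedge X Y x₀ y₀) :=
  inferInstanceAs (TopologicalSpace (Quot (WedgeRel x₀ y₀)))

/-- The relation on `X × [0, 1] ⊔ {S, N}` that identifies `X × {0}` with `S` and `X × {1}` with
`N`. -/
inductive SuspensionRel (X : Type u) :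
    (X × unitInterval) ⊕ Bool → (X × unitInterval) ⊕ Bool → Prop
  | south (x : X) : SuspensionRel X (Sum.inl (x, 0)) (Sum.inr false)
  | north (x : X) : SuspensionRel X (Sum.inl (x, 1)) (Sum.inr true)

/-- The unreduced suspension of `X`; the suspension of the empty space consists of the two
poles. -/
def Suspension (X : Type u) [TopologicalSpace X] : Type u := Quot (SuspensionRel X)

instance (X : Type u) [TopologicalSpace X] : TopologicalSpace (Suspension X) :=
  inferInstanceAs (TopologicalSpace (Quot (SuspensionRel X)))

/-- The south pole of the unreduced suspension. -/
def Suspension.south (X : Type u) [TopologicalSpace X] : Suspension X := Quot.mk _ (Sum.inr false)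

/-- The subspace `X × {0, 1} ∪ {x₀} × [0, 1]` of `X × [0, 1]`. -/
def suspensionSet {X : Type u} (x₀ : X) : Set (X × unitInterval) :=
  {p | p.1 = x₀ ∨ p.2 = 0 ∨ p.2 = 1}

/-- The reduced suspension of `X` at the base point `x₀`. -/
abbrev ReducedSuspension (X : Type u) [TopologicalSpace X] (x₀ : X) : Type u :=
  Collapse (X × unitInterval) (suspensionSet x₀)

/-- The base point of the reduced suspension. -/
abbrev ReducedSuspension.base {X : Type u} [TopologicalSpace X] (x₀ : X) :
    ReducedSuspension X x₀ :=
  Collapse.base (suspensionSet x₀)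

/-! ## Reduced and relative singular homology -/

noncomputable section

/-- The augmentation `C₀(X; G) → G` of the singular chain complex, the sum of the coefficients. -/
def augmentation (G : AddCommGrpCat.{u}) (X : TopCat.{u}) :
    (((AlgebraicTopology.singularChainComplexFunctor AddCommGrpCat.{u}).obj G).obj X).X 0 ⟶ G :=
  Limits.Sigma.desc fun _ => 𝟙 G

theorem d_augmentation (G : AddCommGrpCat.{u}) (X : TopCat.{u}) :
    (((AlgebraicTopology.singularChainComplexFunctor AddCommGrpCat.{u}).obj G).obj X).d 1 0 ≫
      augmentation G X = 0 := by
  let ε : ((TopCat.toSSet.obj X).chainComplex G).X 0 ⟶ G := augmentation G X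
  have h (x) : (TopCat.toSSet.obj X).ιChainComplex (R := G) (n := 0) x ≫ ε = 𝟙 G :=
    Limits.Sigma.ι_desc _ _
  change ((TopCat.toSSet.obj X).chainComplex G).d (0 + 1) 0 ≫ ε = 0
  refine SSet.chainComplex_hom_ext fun x => ?_
  rw [SSet.ιChainComplex_d_assoc, Preadditive.sum_comp]
  simp [Fin.sum_univ_succ, h]

theorem map_augmentation (G : AddCommGrpCat.{u}) {X Y : TopCat.{u}} (f : X ⟶ Y) :
    (((AlgebraicTopology.singularChainComplexFunctor AddCommGrpCat.{u}).obj G).map f).f 0 ≫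
      augmentation G Y = augmentation G X := by
  have h (Z : TopCat.{u}) (x) :
      (TopCat.toSSet.obj Z).ιChainComplex (R := G) (n := 0) x ≫ augmentation G Z = 𝟙 G :=
    Limits.Sigma.ι_desc _ _
  refine SSet.chainComplex_hom_ext (X := TopCat.toSSet.obj X) (R := G) fun x => ?_
  refine (SSet.ι_chainComplexMap_f_assoc (R := G) (TopCat.toSSet.obj X) (TopCat.toSSet.obj Y)
    (TopCat.toSSet.map f) x (augmentation G Y)).trans ?_
  rw [h, h]

/-- The augmented singular chain complex `⋯ → C₁(X; G) → C₀(X; G) → G → 0 → ⋯`, with `G` in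
degree `-1`. -/
def augmentedChains (G : AddCommGrpCat.{u}) (X : TopCat.{u}) :
    ChainComplex AddCommGrpCat.{u} ℤ where
  X
    | Int.ofNat n =>
      (((AlgebraicTopology.singularChainComplexFunctor AddCommGrpCat.{u}).obj G).obj X).X n
    | Int.negSucc 0 => G
    | Int.negSucc (_ + 1) => AddCommGrpCat.of PUnit
  d
    | Int.ofNat m, Int.ofNat n =>
      (((AlgebraicTopology.singularChainComplexFunctor AddCommGrpCat.{u}).obj G).obj X).d m n
    | Int.ofNat 0, Int.negSucc 0 => augmentation G X
    | Int.ofNat 0, Int.negSucc (_ + 1) => 0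
    | Int.ofNat (_ + 1), Int.negSucc _ => 0
    | Int.negSucc _, _ => 0
  shape := by
    rintro (m | m) (n | n) h
    · exact HomologicalComplex.shape _ _ _ fun h' => h (by
        simp only [ComplexShape.down_Rel] at h' ⊢
        subst h'
        rfl)
    · obtain _ | m := m
      · obtain _ | n := n
        · exact absurd rfl h
        · rfl
      · cases n <;> rfl
    · rfl
    · rfl
  d_comp_d' := by
    rintro (i | i) (j | j) (k | k) hij hjk
    · exact HomologicalComplex.d_comp_d _ _ _ _
    · simp only [ComplexShape.down_Rel] at hij hjk
      obtain _ | k := k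
      · obtain rfl : j = 0 := by simp only [Int.ofNat_eq_natCast] at hjk; lia
        obtain rfl : i = 1 := by simp only [Int.ofNat_eq_natCast] at hij; lia
        exact d_augmentation G X
      · simp only [Int.ofNat_eq_natCast] at hjk
        lia
    · exact Limits.comp_zero
    · exact Limits.comp_zero
    · exact Limits.zero_comp
    · exact Limits.zero_comp
    · exact Limits.zero_comp
    · exact Limits.zero_comp

/-- The map of augmented singular chain complexes induced by a continuous map; it is the identity
of `G` in degree `-1`. -/
def augmentedChainsMap (G : AddCommGrpCat.{u}) {X Y : TopCat.{u}} (f : X ⟶ Y) :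
    augmentedChains G X ⟶ augmentedChains G Y where
  f
    | Int.ofNat n =>
      (((AlgebraicTopology.singularChainComplexFunctor AddCommGrpCat.{u}).obj G).map f).f n
    | Int.negSucc 0 => 𝟙 G
    | Int.negSucc (_ + 1) => 𝟙 _
  comm' := by
    rintro (i | i) (j | j) hij
    · exact HomologicalComplex.Hom.comm _ _ _
    · obtain _ | j := j
      · simp only [ComplexShape.down_Rel] at hij
        obtain rfl : i = 0 := by simp only [Int.ofNat_eq_natCast] at hij; lia
        exact (map_augmentation G f).trans (Category.comp_id _).symm
      · simp only [ComplexShape.down_Rel, Int.ofNat_eq_natCast] at hij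
        lia
    · exact Limits.comp_zero.trans Limits.zero_comp.symm
    · exact Limits.comp_zero.trans Limits.zero_comp.symm

theorem mono_augmentedChainsMap (G : AddCommGrpCat.{u}) {X Y : TopCat.{u}} (f : X ⟶ Y)
    (hf : Function.Injective f) : Mono (augmentedChainsMap G f) := by
  have : Mono f := (TopCat.mono_iff_injective f).mpr hf
  have (n : ℤ) : Mono ((augmentedChainsMap G f).f n) := by
    obtain n | n := n
    · exact inferInstanceAs (Mono
        ((((AlgebraicTopology.singularChainComplexFunctor AddCommGrpCat.{u}).obj G).map f).f n))
    · obtain _ | n := n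
      · exact inferInstanceAs (Mono (𝟙 G))
      · exact inferInstanceAs (Mono (𝟙 (AddCommGrpCat.of PUnit.{u + 1})))
  exact HomologicalComplex.mono_of_mono_f _ this

/-- The reduced homology `H̃ₖ(X; G)`, for all `k : ℤ`. It vanishes in negative degrees, except that
`H̃₋₁(∅; G) = G`. -/
abbrev reducedHomology (G : AddCommGrpCat.{u}) (X : Type u) [TopologicalSpace X] (k : ℤ) :
    AddCommGrpCat.{u} :=
  (augmentedChains G (TopCat.of X)).homology k

/-- The map in reduced homology induced by a continuous map. -/
abbrev reducedHomologyMap (G : AddCommGrpCat.{u}) {X Y : Type u} [TopologicalSpace X]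
    [TopologicalSpace Y] (f : C(X, Y)) (k : ℤ) : reducedHomology G X k ⟶ reducedHomology G Y k :=
  HomologicalComplex.homologyMap (augmentedChainsMap G (TopCat.ofHom f)) k

/-- The sequence of complexes `0 → C̃(A; G) → C̃(X; G) → C(X, A; G) → 0` of a continuous map
`f : A → X`, with the cokernel of `f` on augmented singular chains on the right. -/
def pairSequence (G : AddCommGrpCat.{u}) {A X : Type u} [TopologicalSpace A]
    [TopologicalSpace X] (f : C(A, X)) : ShortComplex (ChainComplex AddCommGrpCat.{u} ℤ) :=
  ShortComplex.mk (augmentedChainsMap G (TopCat.ofHom f))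
    (Limits.cokernel.π (augmentedChainsMap G (TopCat.ofHom f))) (Limits.cokernel.condition _)

theorem pairSequence_shortExact (G : AddCommGrpCat.{u}) {A X : Type u} [TopologicalSpace A]
    [TopologicalSpace X] (f : C(A, X)) (hf : Function.Injective f) :
    (pairSequence G f).ShortExact where
  exact := ShortComplex.exact_cokernel _
  mono_f := mono_augmentedChainsMap G _ hf
  epi_g := Limits.coequalizer.π_epi

/-- The relative homology `H̃ₖ(X, A; G)` of a pair given by an injective map `f : A → X`. -/
abbrev relativeHomology (G : AddCommGrpCat.{u}) {A X : Type u} [TopologicalSpace A]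
    [TopologicalSpace X] (f : C(A, X)) (k : ℤ) : AddCommGrpCat.{u} :=
  (pairSequence G f).X₃.homology k

/-- The segment `H̃ₖ(X; G) → H̃ₖ(X, A; G) → H̃ₖ₋₁(A; G)` of the long exact sequence of a pair, with
the connecting homomorphism as the second map. -/
def pairHomologySegment (G : AddCommGrpCat.{u}) {A X : Type u} [TopologicalSpace A]
    [TopologicalSpace X] (f : C(A, X)) (hf : Function.Injective f) (k : ℤ) :
    ShortComplex AddCommGrpCat.{u} :=
  ShortComplex.mk (X₁ := reducedHomology G X k) (X₂ := relativeHomology G f k)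
    (X₃ := reducedHomology G A (k - 1))
    (HomologicalComplex.homologyMap (pairSequence G f).g k)
    ((pairSequence_shortExact G f hf).δ k (k - 1) (by simp))
    ((pairSequence_shortExact G f hf).comp_δ k (k - 1) _)

end

end MorseMatching

open MorseMatching
open scoped ContinuousMap

/-! Fix a vertex `w` of `K` and put `p = ({v}, {v, w})`. Adding `p` to a gradient vector field on
`K` gives one on `CK`: a gradient step never ends in a simplex containing `v`, so no closed path
uses the new pair. Hence `M(CK)` contains the cone `p * M(K)`, and the inclusion `i` factors through
a contractible space `C`. It is therefore null-homotopic and zero on reduced homology, so the long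
exact sequence breaks up. A section of the connecting map is `H̃ₖ₋₁(A) ≅ H̃ₖ(C, A) → H̃ₖ(X, A)`,
where `A = M(K)` and `X = M(CK)` (`pairHomologySegment_splitting_of_factor`). Part (B) is the case
`Δⁿ = CΔⁿ⁻¹`.

For the cofiber, `A` is the full subcomplex of `X` on the set `B` of pairs of simplices of `K`, and
`X` contains `p * A` (`IsConePair`). The equivalence `X / A ≃ X ∨ ΣA` is built from explicit maps.
In one direction, `X` maps by the projection and `ΣA` by `(p * A) / A ⊆ X / A`. In the other, a
neighbourhood of the cone, measured by the mass `u` of a point outside `p * A`, is pushed into the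
cone. Its part `u ≤ 1/4` is sent to `ΣA`, while the rest is stretched over `X` with the locus `u =
1/4` going to the apex. One composite is exactly the identity on `ΣA`; the other homotopies come
from the deformation `push` (`IsConePair.collapse_equiv`).

This produces a wedge at the apex. Any base point in the same path component serves as well, by
prefixing meridians with a path. If `M(K)` is non-empty, every vertex of `M(CK)` can be joined to an
apex `({v}, {v, w})` for a suitable `w`, using that two disjoint pairs always form an acyclic
matching. If `M(K)` is empty, `M(CK)` may be disconnected, but then any vertex is an apex of the
cone over the empty complex (`exists_isConePair_joined`). Points of a realization have contractible
neighbourhoods in the sense of `Realization.exists_contraction`, which allows the reduced suspension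
instead. -/

namespace MorseMatching

noncomputable section

/-! ### Homotopy invariance of reduced homology, and its vanishing on contractible spaces. -/

/-- The (non-augmented) singular chain complex. -/
abbrev singularChains (G : AddCommGrpCat.{u}) (X : TopCat.{u}) : ChainComplex AddCommGrpCat.{u} ℕ :=
  ((AlgebraicTopology.singularChainComplexFunctor AddCommGrpCat.{u}).obj G).obj X

/-- The extension by zero of a family of maps of singular chains to augmented chains. -/
def augmentedHom (G : AddCommGrpCat.{u}) {X Y : TopCat.{u}} (e : G ⟶ (singularChains G Y).X 0)
    (h : ∀ m n, (singularChains G X).X m ⟶ (singularChains G Y).X n) :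
    ∀ i j, (augmentedChains G X).X i ⟶ (augmentedChains G Y).X j
  | Int.ofNat m, Int.ofNat n => h m n
  | Int.negSucc 0, Int.ofNat 0 => e
  | Int.negSucc 0, Int.ofNat (_ + 1) => 0
  | Int.ofNat _, Int.negSucc _ => 0
  | Int.negSucc 0, Int.negSucc _ => 0
  | Int.negSucc (_ + 1), _ => 0

/-- A homotopy of maps of augmented singular chain complexes, from its components. -/
def augmentedHomotopy (G : AddCommGrpCat.{u}) {X Y : TopCat.{u}}
    {f g : augmentedChains G X ⟶ augmentedChains G Y}
    (f₀ g₀ : ∀ n, (singularChains G X).X n ⟶ (singularChains G Y).X n) (f₁ g₁ : G ⟶ G)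
    (hf₀ : ∀ n, f.f (Int.ofNat n) = f₀ n) (hg₀ : ∀ n, g.f (Int.ofNat n) = g₀ n)
    (hf₁ : f.f (Int.negSucc 0) = f₁) (hg₁ : g.f (Int.negSucc 0) = g₁)
    (e : G ⟶ (singularChains G Y).X 0)
    (h : ∀ m n, (singularChains G X).X m ⟶ (singularChains G Y).X n)
    (hz : ∀ m n, m + 1 ≠ n → h m n = 0)
    (hs : ∀ n : ℕ, f₀ (n + 1) = (singularChains G X).d (n + 1) n ≫ h n (n + 1) +
      h (n + 1) (n + 2) ≫ (singularChains G Y).d (n + 2) (n + 1) + g₀ (n + 1))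
    (h0 : f₀ 0 = augmentation G X ≫ e + h 0 1 ≫ (singularChains G Y).d 1 0 + g₀ 0)
    (h1 : f₁ = e ≫ augmentation G Y + g₁) :
    _root_.Homotopy f g where
  hom := augmentedHom G e h
  zero := by
    rintro (i | _ | i) (j | j) hij
    · exact hz _ _ fun h' => hij (by
          simp only [ComplexShape.down_Rel] at h' ⊢
          subst h'
          rfl)
    · rfl
    · obtain _ | j := j
      · exact absurd rfl hij
      · rfl
    · rfl
    · rfl
    · rfl
  -- In degree `0` the differential leaving the complex is the augmentation, followed by `e`. In
  -- degree `-1` only `e` followed by the augmentation survives, and below that the groups are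
  -- trivial.
  comm := by
    rintro (i | i)
    · obtain _ | i := i
      · rw [dNext_eq _ (show (ComplexShape.down ℤ).Rel (Int.ofNat 0) (Int.negSucc 0) from rfl),
          prevD_eq _ (show (ComplexShape.down ℤ).Rel (Int.ofNat 1) (Int.ofNat 0) from rfl)]
        exact (hf₀ 0).trans (h0.trans (congrArg₂ (· + ·) rfl (hg₀ 0).symm))
      · rw [dNext_eq _ (show (ComplexShape.down ℤ).Rel (Int.ofNat (i + 1)) (Int.ofNat i) from rfl),
          prevD_eq _ (show (ComplexShape.down ℤ).Rel (Int.ofNat (i + 2)) (Int.ofNat (i + 1)) from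
            rfl)]
        exact (hf₀ _).trans ((hs i).trans (congrArg₂ (· + ·) rfl (hg₀ _).symm))
    · obtain _ | i := i
      · rw [dNext_eq _ (show (ComplexShape.down ℤ).Rel (Int.negSucc 0) (Int.negSucc 1) from rfl),
          prevD_eq _ (show (ComplexShape.down ℤ).Rel (Int.ofNat 0) (Int.negSucc 0) from rfl)]
        refine hf₁.trans (h1.trans (congrArg₂ (· + ·) ?_ hg₁.symm))
        refine (zero_add _).symm.trans ?_
        exact congrArg₂ (· + ·) Limits.comp_zero.symm rfl
      · have : Subsingleton ((augmentedChains G X).X (Int.negSucc (i + 1))) :=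
          inferInstanceAs (Subsingleton PUnit)
        refine ConcreteCategory.hom_ext _ _ fun x => ?_
        obtain rfl : x = 0 := Subsingleton.elim _ _
        simp only [map_zero]

theorem isZero_homology_of_homotopy {C : ChainComplex AddCommGrpCat.{u} ℤ}
    (h : _root_.Homotopy (𝟙 C) 0) (k : ℤ) : Limits.IsZero (C.homology k) := by
  rw [Limits.IsZero.iff_id_eq_zero, ← HomologicalComplex.homologyMap_id, h.homologyMap_eq]
  simp

theorem augmentedChainsMap_id (G : AddCommGrpCat.{u}) (X : TopCat.{u}) :
    augmentedChainsMap G (𝟙 X) = 𝟙 _ := by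
  ext1 (i | _ | i)
  · exact congrArg (fun φ => HomologicalComplex.Hom.f φ i)
      (((AlgebraicTopology.singularChainComplexFunctor AddCommGrpCat.{u}).obj G).map_id X)
  · rfl
  · rfl

theorem augmentedChainsMap_comp (G : AddCommGrpCat.{u}) {X Y Z : TopCat.{u}} (f : X ⟶ Y)
    (g : Y ⟶ Z) :
    augmentedChainsMap G (f ≫ g) = augmentedChainsMap G f ≫ augmentedChainsMap G g := by
  ext1 (i | _ | i)
  · exact congrArg (fun φ => HomologicalComplex.Hom.f φ i)
      (((AlgebraicTopology.singularChainComplexFunctor AddCommGrpCat.{u}).obj G).map_comp f g)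
  · exact (Category.comp_id _).symm
  · exact (Category.comp_id _).symm

theorem reducedHomologyMap_comp (G : AddCommGrpCat.{u}) {X Y Z : Type u} [TopologicalSpace X]
    [TopologicalSpace Y] [TopologicalSpace Z] (f : C(X, Y)) (g : C(Y, Z)) (k : ℤ) :
    reducedHomologyMap G (g.comp f) k = reducedHomologyMap G f k ≫ reducedHomologyMap G g k := by
  rw [reducedHomologyMap, TopCat.ofHom_comp, augmentedChainsMap_comp,
    HomologicalComplex.homologyMap_comp]

theorem reducedHomologyMap_id (G : AddCommGrpCat.{u}) (X : Type u) [TopologicalSpace X] (k : ℤ) :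
    reducedHomologyMap G (ContinuousMap.id X) k = 𝟙 _ := by
  rw [reducedHomologyMap, TopCat.ofHom_id, augmentedChainsMap_id,
    HomologicalComplex.homologyMap_id]

/-- The chain homotopy of singular chains extends by zero to degree `-1`, where both maps are the
identity of `G`. -/
theorem reducedHomologyMap_eq_of_homotopic (G : AddCommGrpCat.{u}) {X Y : Type u}
    [TopologicalSpace X] [TopologicalSpace Y] {f g : C(X, Y)} (h : f.Homotopic g) (k : ℤ) :
    reducedHomologyMap G f k = reducedHomologyMap G g k := by
  obtain ⟨H⟩ := h
  let h' := TopCat.Homotopy.singularChainComplexFunctorObjMap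
    (f := TopCat.ofHom f) (g := TopCat.ofHom g) H G
  refine Homotopy.homologyMap_eq (augmentedHomotopy G _ _ _ _ (fun _ => rfl) (fun _ => rfl) rfl rfl
    0 h'.hom (fun m n hmn => h'.zero _ _ hmn) (fun n => ?_) ?_ ?_) k
  · have := h'.comm (n + 1)
    rwa [Homotopy.dNext_succ_chainComplex, Homotopy.prevD_chainComplex] at this
  · have := h'.comm 0
    rw [Homotopy.dNext_zero_chainComplex, Homotopy.prevD_chainComplex] at this
    rw [Limits.comp_zero]
    exact this
  · exact (zero_add (𝟙 G)).symm.trans (congrArg (· + 𝟙 G) Limits.zero_comp.symm)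

/-- A point has one singular simplex in each degree. Sending it to the one in the next degree, and
`G` in degree `-1` to the `0`-simplex, contracts the augmented complex. -/
theorem isZero_reducedHomology_punit (G : AddCommGrpCat.{u}) (k : ℤ) :
    Limits.IsZero (reducedHomology G PUnit.{u + 1} k) := by
  let X : SSet.{u} := TopCat.toSSet.obj (TopCat.of PUnit.{u + 1})
  let pt (n : ℕ) : X.obj (Opposite.op (SimplexCategory.mk n)) :=
    TopCat.toSSetObjEquiv _ _ |>.symm (ContinuousMap.const _ PUnit.unit)
  have hpt (n : ℕ) (x y : X.obj (Opposite.op (SimplexCategory.mk n))) : x = y :=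
    (TopCat.toSSetObjEquiv _ _).injective (ContinuousMap.ext fun _ => rfl)
  let H (n : ℕ) : (X.chainComplex G).X n ⟶ (X.chainComplex G).X (n + 1) :=
    Limits.Sigma.desc fun _ => X.ιChainComplex (pt (n + 1))
  -- The homotopy is indexed by all pairs of degrees; `eqToHom` only transports along `m + 1 = n`.
  let h (m n : ℕ) : (X.chainComplex G).X m ⟶ (X.chainComplex G).X n :=
    if hmn : m + 1 = n then H m ≫ eqToHom (by rw [hmn]) else 0
  have hh (n : ℕ) : h n (n + 1) = H n := by simp [h]
  have hι (n : ℕ) (x) : X.ιChainComplex (R := G) (n := n) x ≫ H n = X.ιChainComplex (pt (n + 1)) :=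
    Limits.Sigma.ι_desc _ _
  let ε : (X.chainComplex G).X 0 ⟶ G := augmentation G _
  have hε (x) : X.ιChainComplex (R := G) (n := 0) x ≫ ε = 𝟙 G :=
    Limits.Sigma.ι_desc _ _
  have hdH (n : ℕ) : 𝟙 ((X.chainComplex G).X (n + 1)) =
      (X.chainComplex G).d (n + 1) n ≫ H n + H (n + 1) ≫ (X.chainComplex G).d (n + 2) (n + 1) := by
    refine SSet.chainComplex_hom_ext fun x => ?_
    obtain rfl := hpt _ x (pt (n + 1))
    simp only [Preadditive.comp_add, SSet.ιChainComplex_d_assoc, Preadditive.sum_comp,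
      Preadditive.zsmul_comp, hι, reassoc_of% hι, SSet.ιChainComplex_d, Category.comp_id]
    -- All faces coincide, so the two boundaries are alternating sums of `n + 2` and `n + 3` signs.
    -- According to the parity of `n`, one of them is `0` and the other `1`.
    simp only [hpt _ _ (pt (n + 1)), ← Finset.sum_smul, Fin.sum_univ_castSucc (n := n + 2),
      Fin.val_castSucc, ← add_smul, Fin.sum_neg_one_pow, Fin.val_last]
    rcases Nat.even_or_odd n with hn | hn
    · simp [hn, pow_add, Nat.even_add]
    · simp [Nat.not_even_iff_odd.2 hn, hn, pow_add, Nat.even_add]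
  have hd0 : 𝟙 ((X.chainComplex G).X 0) =
      ε ≫ X.ιChainComplex (pt 0) + H 0 ≫ (X.chainComplex G).d 1 0 := by
    refine SSet.chainComplex_hom_ext fun x => ?_
    obtain rfl := hpt _ x (pt 0)
    rw [Preadditive.comp_add, reassoc_of% hι, SSet.ιChainComplex_d, reassoc_of% hε]
    simp [hpt _ _ (pt 0), Fin.sum_univ_succ]
  refine isZero_homology_of_homotopy (augmentedHomotopy G (fun n => 𝟙 _) 0 (𝟙 _) 0
    (fun _ => rfl) (fun _ => rfl) rfl rfl (X.ιChainComplex (pt 0)) h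
    (fun m n hmn => dif_neg hmn) (fun n => ?_) ?_ ?_) k
  · rw [hh, hh]
    exact (hdH n).trans (add_zero _).symm
  · rw [hh]
    exact hd0.trans (add_zero _).symm
  · exact ((add_zero _).trans (hε _)).symm

theorem isZero_reducedHomology_of_contractible (G : AddCommGrpCat.{u}) (X : Type u)
    [TopologicalSpace X] [ContractibleSpace X] (k : ℤ) :
    Limits.IsZero (reducedHomology G X k) := by
  obtain ⟨x, hx⟩ := (contractible_iff_id_nullhomotopic X).1 inferInstance
  rw [Limits.IsZero.iff_id_eq_zero, ← reducedHomologyMap_id,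
    reducedHomologyMap_eq_of_homotopic G hx,
    show ContinuousMap.const X x = (ContinuousMap.const PUnit.{u + 1} x).comp
      (ContinuousMap.const X PUnit.unit) from rfl, reducedHomologyMap_comp,
    (isZero_reducedHomology_punit G k).eq_zero_of_tgt (reducedHomologyMap G (.const X PUnit.unit) k),
    Limits.zero_comp]

/-! ### Pairs `A ⊆ X` that factor through a contractible subspace -/

section Factor

variable (G : AddCommGrpCat.{u}) {A C X : Type u} [TopologicalSpace A] [TopologicalSpace C]
  [TopologicalSpace X] [ContractibleSpace C] (a : C(A, C)) (j : C(C, X))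

theorem reducedHomologyMap_eq_zero_of_factor (k : ℤ) :
    reducedHomologyMap G (j.comp a) k = 0 := by
  rw [reducedHomologyMap_comp, (isZero_reducedHomology_of_contractible G C k).eq_zero_of_tgt
    (reducedHomologyMap G a k),
    Limits.zero_comp]

/-- The map of pairs `(C, A) → (X, A)` on chains. -/
def pairSequenceMap : pairSequence G a ⟶ pairSequence G (j.comp a) where
  τ₁ := 𝟙 _
  τ₂ := augmentedChainsMap G (TopCat.ofHom j)
  τ₃ := Limits.cokernel.map _ _ (𝟙 _) (augmentedChainsMap G (TopCat.ofHom j)) (by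
    rw [← augmentedChainsMap_comp, Category.id_comp]
    rfl)
  comm₁₂ := by
    dsimp [pairSequence]
    rw [← augmentedChainsMap_comp, Category.id_comp]
  comm₂₃ := by
    simp [pairSequence]

variable (hi : Function.Injective (j.comp a))

/-- Exactness in the middle always holds. The vanishing of the map of the inclusion in degree `k`
gives injectivity on the left, and in degree `k - 1` surjectivity on the right. -/
theorem pairHomologySegment_shortExact_of_factor (k : ℤ) :
    (pairHomologySegment G (j.comp a) hi k).ShortExact := by
  have hS := pairSequence_shortExact G (j.comp a) hi
  have h0 (k : ℤ) : HomologicalComplex.homologyMap (pairSequence G (j.comp a)).f k = 0 :=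
    reducedHomologyMap_eq_zero_of_factor G a j k
  have hr : (ComplexShape.down ℤ).Rel k (k - 1) := by simp
  refine { exact := hS.homology_exact₃ k (k - 1) hr, mono_f := ?_, epi_g := ?_ }
  · exact (hS.homology_exact₂ k).mono_g (h0 k)
  · exact (hS.homology_exact₁ k (k - 1) hr).epi_f (h0 (k - 1))

/-- Since `C` is contractible, the connecting map of `(C, A)` is an isomorphism. Its inverse
followed by the map of pairs `(C, A) → (X, A)` is a section, by naturality of the connecting map. -/
theorem pairHomologySegment_splitting_of_factor (k : ℤ) :
    Nonempty (pairHomologySegment G (j.comp a) hi k).Splitting := by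
  have hS := pairSequence_shortExact G (j.comp a) hi
  have ha : Function.Injective a := Function.Injective.of_comp hi
  have hT := pairSequence_shortExact G a ha
  have hr : (ComplexShape.down ℤ).Rel k (k - 1) := by simp
  let e := hT.δIso k (k - 1) hr (isZero_reducedHomology_of_contractible G C k)
    (isZero_reducedHomology_of_contractible G C (k - 1))
  have hnat := HomologicalComplex.HomologySequence.δ_naturality (pairSequenceMap G a j) hT hS
    k (k - 1) hr
  have := (pairHomologySegment_shortExact_of_factor G a j hi k).mono_f
  refine ⟨ShortComplex.Splitting.ofExactOfSection _
    (pairHomologySegment_shortExact_of_factor G a j hi k).exact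
    (e.inv ≫ HomologicalComplex.homologyMap (pairSequenceMap G a j).τ₃ k) ?_ this⟩
  change (_ ≫ _) ≫ hS.δ k (k - 1) hr = 𝟙 _
  refine (Category.assoc _ _ _).trans ((congrArg (e.inv ≫ ·) hnat.symm).trans ?_)
  refine (e.inv_hom_id_assoc _).trans ?_
  exact HomologicalComplex.homologyMap_id _ _

end Factor

theorem addEquiv_of_splitting {S : ShortComplex AddCommGrpCat.{u}} (s : S.Splitting) :
    Nonempty (S.X₂ ≃+ S.X₁ × S.X₃) :=
  ⟨(s.isoBinaryBiproduct ≪≫ AddCommGrpCat.biprodIsoProd _ _).addCommGroupIsoToAddEquiv⟩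

end

open unitInterval

/-! ### Maps and homotopies out of quotients, wedges and suspensions -/

section Quotients

variable {X Y Z T : Type u} [TopologicalSpace X] [TopologicalSpace Y] [TopologicalSpace Z]
  [TopologicalSpace T]

/-- A homotopy compatible with a relation descends to the quotient. -/
def quotHomotopy {r : X → X → Prop} (H : C(I × X, T))
    (h : ∀ t a b, r a b → H (t, a) = H (t, b)) : C(I × Quot r, T) :=
  -- Currying replaces a map on `I × Quot r` by one on `Quot r`, whose continuity is immediate.
  -- Uncurrying is legitimate since `I` is locally compact.
  let F : C(Quot r, C(I, T)) :=
    ⟨Quot.lift (H.comp .prodSwap).curry fun a b hab => ContinuousMap.ext fun t => h t a b hab,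
      continuous_quot_lift _ (H.comp .prodSwap).curry.continuous⟩
  F.uncurry.comp .prodSwap

/-- A homotopy on a disjoint union. -/
def sumHomotopy {Y' : Type*} [TopologicalSpace Y'] (H : C(I × X, T)) (H' : C(I × Y', T)) :
    C(I × (X ⊕ Y'), T) :=
  let F : C(X ⊕ Y', C(I, T)) :=
    ⟨Sum.elim (H.comp .prodSwap).curry (H'.comp .prodSwap).curry,
      (H.comp .prodSwap).curry.continuous.sumElim (H'.comp .prodSwap).curry.continuous⟩
  F.uncurry.comp .prodSwap

namespace Wedge

variable (x₀ : X) (y₀ : Y)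

/-- The inclusion of the first summand of a wedge. -/
def inl : C(X, Wedge X Y x₀ y₀) := ⟨fun x => Quot.mk _ (Sum.inl x), by
  exact continuous_quot_mk.comp continuous_inl⟩

/-- The inclusion of the second summand of a wedge. -/
def inr : C(Y, Wedge X Y x₀ y₀) := ⟨fun y => Quot.mk _ (Sum.inr y), by
  exact continuous_quot_mk.comp continuous_inr⟩

theorem glue : inl x₀ y₀ x₀ = inr x₀ y₀ y₀ := Quot.sound .glue

variable {x₀ y₀}

@[elab_as_elim]
theorem ind {P : Wedge X Y x₀ y₀ → Prop} (h : ∀ x, P (inl x₀ y₀ x)) (h' : ∀ y, P (inr x₀ y₀ y))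
    (z : Wedge X Y x₀ y₀) : P z := by
  obtain ⟨x | y⟩ := z
  exacts [h x, h' y]

/-- A homotopy on a wedge. -/
def homotopy (H : C(I × X, T)) (H' : C(I × Y, T)) (h : ∀ t, H (t, x₀) = H' (t, y₀)) :
    C(I × Wedge X Y x₀ y₀, T) :=
  quotHomotopy (sumHomotopy H H') (by rintro t _ _ ⟨⟩; exact h t)

/-- A map on a wedge. -/
def lift (f : C(X, T)) (g : C(Y, T)) (h : f x₀ = g y₀) : C(Wedge X Y x₀ y₀, T) :=
  ⟨Quot.lift (Sum.elim f g) (by rintro _ _ ⟨⟩; exact h), by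
    exact continuous_quot_lift _ (f.continuous.sumElim g.continuous)⟩

theorem homotopic {f g : C(Wedge X Y x₀ y₀, T)} (H : C(I × X, T)) (H' : C(I × Y, T))
    (h : ∀ t, H (t, x₀) = H' (t, y₀))
    (h₀ : ∀ x, H (0, x) = f (inl _ _ x)) (h₁ : ∀ x, H (1, x) = g (inl _ _ x))
    (h₀' : ∀ y, H' (0, y) = f (inr _ _ y)) (h₁' : ∀ y, H' (1, y) = g (inr _ _ y)) :
    f.Homotopic g :=
  ⟨{ toContinuousMap := homotopy H H' h
     map_zero_left := ind h₀ h₀'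
     map_one_left := ind h₁ h₁' }⟩

end Wedge

namespace Collapse

variable (A : Set X)

/-- The quotient map `X → X / A`. -/
def proj : C(X, Collapse X A) := ⟨fun x => Quot.mk _ (Sum.inl x), by
  exact continuous_quot_mk.comp continuous_inl⟩

variable {A}

theorem proj_eq {a : X} (ha : a ∈ A) : proj A a = base A := Quot.sound (.collapse a ha)

@[elab_as_elim]
theorem ind {P : Collapse X A → Prop} (h : ∀ x, P (proj A x)) (h' : P (base A))
    (z : Collapse X A) : P z := by
  obtain ⟨x | ⟨⟩⟩ := z
  exacts [h x, h']

/-- A map on `X / A`. -/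
def lift (f : C(X, T)) (t : T) (h : ∀ a ∈ A, f a = t) : C(Collapse X A, T) :=
  ⟨Quot.lift (Sum.elim f fun _ => t) (by rintro _ _ ⟨a, ha⟩; exact h a ha), by
    exact continuous_quot_lift _ (f.continuous.sumElim continuous_const)⟩

/-- A homotopy on `X / A`. -/
def homotopy (H : C(I × X, T)) (b : C(I, T)) (h : ∀ t, ∀ a ∈ A, H (t, a) = b t) :
    C(I × Collapse X A, T) :=
  quotHomotopy (sumHomotopy H (b.comp .fst)) (by rintro t _ _ ⟨a, ha⟩; exact h t a ha)

theorem homotopicRel {f g : C(Collapse X A, T)} (H : C(I × X, T)) (t : T)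
    (h : ∀ s, ∀ a ∈ A, H (s, a) = t)
    (h₀ : ∀ x, H (0, x) = f (proj A x)) (h₁ : ∀ x, H (1, x) = g (proj A x))
    (h₀' : f (base A) = t) (h₁' : g (base A) = t) :
    f.HomotopicRel g {base A} :=
  ⟨{ toContinuousMap := homotopy H (.const I t) h
     map_zero_left := ind h₀ h₀'.symm
     map_one_left := ind h₁ h₁'.symm
     prop' := by rintro s _ rfl; exact h₀'.symm }⟩

end Collapse

namespace Suspension

variable (X)

/-- The north pole of the unreduced suspension. -/
def north : Suspension X := Quot.mk _ (Sum.inr true)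

/-- The quotient map `X × [0, 1] → ΣX`. -/
def mk : C(X × I, Suspension X) := ⟨fun x => Quot.mk _ (Sum.inl x), by
  exact continuous_quot_mk.comp continuous_inl⟩

variable {X}

theorem mk_zero (x : X) : mk X (x, 0) = south X := Quot.sound (.south x)

theorem mk_one (x : X) : mk X (x, 1) = north X := Quot.sound (.north x)

@[elab_as_elim]
theorem ind {P : Suspension X → Prop} (h : ∀ x t, P (mk X (x, t))) (hs : P (south X))
    (hn : P (north X)) (z : Suspension X) : P z := by
  obtain ⟨⟨x, t⟩ | (_ | _)⟩ := z
  exacts [h x t, hs, hn]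

/-- A map on a suspension. -/
def lift (f : C(X × I, T)) (s n : T) (hs : ∀ x, f (x, 0) = s) (hn : ∀ x, f (x, 1) = n) :
    C(Suspension X, T) :=
  ⟨Quot.lift (Sum.elim f fun b => bif b then n else s) (by
      rintro _ _ (⟨x⟩ | ⟨x⟩)
      exacts [hs x, hn x]), by
    exact continuous_quot_lift _ (f.continuous.sumElim continuous_of_discreteTopology)⟩

/-- A homotopy on a suspension. -/
def homotopy (H : C(I × (X × I), T)) (s n : C(I, T)) (hs : ∀ t x, H (t, (x, 0)) = s t)
    (hn : ∀ t x, H (t, (x, 1)) = n t) : C(I × Suspension X, T) :=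
  quotHomotopy (sumHomotopy H
    ⟨fun p => bif p.2 then n p.1 else s p.1, by
      refine continuous_prod_of_discrete_right.2 ?_
      rintro (_ | _)
      exacts [s.continuous, n.continuous]⟩) (by
    rintro t _ _ (⟨x⟩ | ⟨x⟩)
    exacts [hs t x, hn t x])

/-- Only the south pole is a base point, so the north pole may travel along a path `n`. The
comparison with the reduced suspension needs this freedom. -/
theorem homotopicRel {f g : C(Suspension X, T)} (H : C(I × (X × I), T)) (s : T) (n : C(I, T))
    (hs : ∀ t x, H (t, (x, 0)) = s) (hn : ∀ t x, H (t, (x, 1)) = n t)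
    (h₀ : ∀ x, H (0, x) = f (mk X x)) (h₁ : ∀ x, H (1, x) = g (mk X x))
    (hs₀ : f (south X) = s) (hs₁ : g (south X) = s)
    (hn₀ : f (north X) = n 0) (hn₁ : g (north X) = n 1) :
    f.HomotopicRel g {south X} :=
  ⟨{ toContinuousMap := homotopy H (.const I s) n hs hn
     map_zero_left := ind (fun x t => h₀ (x, t)) hs₀.symm hn₀.symm
     map_one_left := ind (fun x t => h₁ (x, t)) hs₁.symm hn₁.symm
     prop' := by rintro t _ rfl; exact hs₀.symm }⟩

end Suspension

/-! ### Homotopy equivalences of wedges, and a criterion for splitting a quotient. -/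

/-- The wedge with a fixed space is invariant under pointed homotopy equivalences. -/
theorem wedge_equiv_of_pointed (x₀ : X) {y₀ : Y} {z₀ : Z} (f : C(Y, Z)) (g : C(Z, Y))
    (hf : f y₀ = z₀) (hg : g z₀ = y₀)
    (hgf : (g.comp f).HomotopicRel (.id Y) {y₀}) (hfg : (f.comp g).HomotopicRel (.id Z) {z₀}) :
    Nonempty (Wedge X Y x₀ y₀ ≃ₕ Wedge X Z x₀ z₀) := by
  obtain ⟨H⟩ := hgf
  obtain ⟨H'⟩ := hfg
  refine ⟨{
    toFun := Wedge.lift (Wedge.inl _ _) ((Wedge.inr _ _).comp f) (by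
      rw [ContinuousMap.comp_apply, hf, Wedge.glue])
    invFun := Wedge.lift (Wedge.inl _ _) ((Wedge.inr _ _).comp g) (by
      rw [ContinuousMap.comp_apply, hg, Wedge.glue])
    left_inv := Wedge.homotopic ((Wedge.inl _ _).comp .snd) ((Wedge.inr _ _).comp H.toContinuousMap)
      (fun t => ?_) (fun x => rfl) (fun x => rfl) (fun y => ?_) (fun y => ?_)
    right_inv := Wedge.homotopic ((Wedge.inl _ _).comp .snd)
      ((Wedge.inr _ _).comp H'.toContinuousMap)
      (fun t => ?_) (fun x => rfl) (fun x => rfl) (fun y => ?_) (fun y => ?_) }⟩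
  · exact (Wedge.glue x₀ y₀).trans (congrArg _ ((H.eq_snd t rfl).symm))
  · exact congrArg (Wedge.inr x₀ y₀) (H.map_zero_left y)
  · exact congrArg (Wedge.inr x₀ y₀) (H.map_one_left y)
  · exact (Wedge.glue x₀ z₀).trans (congrArg _ ((H'.eq_snd t rfl).symm))
  · exact congrArg (Wedge.inr x₀ z₀) (H'.map_zero_left y)
  · exact congrArg (Wedge.inr x₀ z₀) (H'.map_one_left y)

/-- A criterion for `X / A ≃ X ∨ Y`. -/
theorem collapse_equiv_wedge {A : Set X} {x₀ : X} {y₀ : Y} (m : C(Y, Collapse X A))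
    (hm : m y₀ = Collapse.proj A x₀) (Φ : C(Collapse X A, Wedge X Y x₀ y₀))
    (hΦm : ∀ y, Φ (m y) = Wedge.inr x₀ y₀ y)
    (hΦ : (Φ.comp (Collapse.proj A)).HomotopicRel (Wedge.inl x₀ y₀) {x₀})
    (ζ : C(I × X, X)) (hζ : ∀ t, ∀ a ∈ A, ζ (t, a) ∈ A)
    (hζ₁ : ∀ x, ζ (1, x) = x)
    (hζ₀ : ∀ x, Wedge.lift (Collapse.proj A) m hm.symm (Φ (Collapse.proj A x)) =
      Collapse.proj A (ζ (0, x)))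
    (hb : Wedge.lift (Collapse.proj A) m hm.symm (Φ (Collapse.base A)) = Collapse.base A) :
    Nonempty (Collapse X A ≃ₕ Wedge X Y x₀ y₀) := by
  obtain ⟨H⟩ := hΦ
  refine ⟨{
    toFun := Φ
    invFun := Wedge.lift (Collapse.proj A) m hm.symm
    -- This composite is induced by `ζ (0, ·)`. As `ζ` preserves `A` at all times, it descends to a
    -- homotopy on `X / A`, which ends at the identity.
    left_inv := (Collapse.homotopicRel ((Collapse.proj A).comp ζ) (Collapse.base A)
      (fun t a ha => ?_) (fun x => ?_) (fun x => ?_) hb rfl).homotopic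
    right_inv := Wedge.homotopic H.toContinuousMap ((Wedge.inr _ _).comp .snd)
      (fun t => ?_) (fun x => ?_) (fun x => ?_) (fun y => ?_) (fun y => ?_) }⟩
  · exact Collapse.proj_eq (hζ t a ha)
  · exact (hζ₀ x).symm
  · exact congrArg (Collapse.proj A) (hζ₁ x)
  · exact (H.eq_snd t rfl).trans (Wedge.glue _ _)
  · exact H.map_zero_left x
  · exact H.map_one_left x
  · exact (hΦm y).symm
  · rfl

end Quotients

/-- The retraction of the real line onto the unit interval. -/
noncomputable abbrev clamp (t : ℝ) : I := Set.projIcc 0 1 zero_le_one t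

theorem clamp_coe (t : I) : clamp t = t := Set.projIcc_val _ t

theorem clamp_of_nonpos {t : ℝ} (h : t ≤ 0) : clamp t = 0 := Set.projIcc_of_le_left _ h

theorem clamp_of_one_le {t : ℝ} (h : 1 ≤ t) : clamp t = 1 := Set.projIcc_of_right_le _ h

theorem coe_clamp (t : ℝ) : (clamp t : ℝ) = max 0 (min 1 t) := Set.coe_projIcc ..

theorem clamp_eq {t : ℝ} {s : I} (h : t = s) : clamp t = s := by rw [h, clamp_coe]

@[fun_prop]
theorem continuous_clamp : Continuous clamp := continuous_projIcc

/-! ### Moving the base point of a wedge with a suspension -/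

section Slide

variable {X A : Type u} [TopologicalSpace X] [TopologicalSpace A] {p q : X}

/-- The map `ΣA → X ∨ ΣA` that prefixes each meridian with a path. -/
noncomputable def slide (ω : Path p q) :
    C(Suspension A, Wedge X (Suspension A) q (Suspension.south A)) :=
  Suspension.lift
    ⟨fun z : A × I => if (z.2 : ℝ) ≤ 1 / 2 then Wedge.inl _ _ (ω (clamp (2 * z.2)))
      else Wedge.inr _ _ (Suspension.mk A (z.1, clamp (2 * z.2 - 1))), by
      refine Continuous.if_le (by fun_prop) (by fun_prop) (by fun_prop) (by fun_prop) ?_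
      intro z hz
      rw [hz, clamp_of_one_le (by norm_num), clamp_of_nonpos (by norm_num), Suspension.mk_zero,
        ω.target, Wedge.glue]⟩
    (Wedge.inl _ _ p) (Wedge.inr _ _ (Suspension.north A))
    (fun x => by
      simp)
    (fun x => by
      have : ¬ (1 : ℝ) ≤ 1 / 2 := by norm_num
      simp only [ContinuousMap.coe_mk, Set.Icc.coe_one, this, if_false]
      rw [clamp_of_one_le (by norm_num), Suspension.mk_one])

theorem slide_mk (ω : Path p q) (a : A) (t : I) : slide ω (Suspension.mk A (a, t)) =
    if (t : ℝ) ≤ 1 / 2 then Wedge.inl _ _ (ω (clamp (2 * t)))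
      else Wedge.inr _ _ (Suspension.mk A (a, clamp (2 * t - 1))) := rfl

/-- The map of wedges that moves the base point along a path. -/
noncomputable def wedgeSlide (ω : Path p q) :
    C(Wedge X (Suspension A) p (Suspension.south A), Wedge X (Suspension A) q (Suspension.south A)) :=
  Wedge.lift (Wedge.inl _ _) (slide ω) rfl

theorem wedgeSlide_inl (ω : Path p q) (x : X) :
    wedgeSlide (A := A) ω (Wedge.inl _ _ x) = Wedge.inl _ _ x := rfl

theorem wedgeSlide_inr (ω : Path p q) (y : Suspension A) :
    wedgeSlide ω (Wedge.inr _ _ y) = slide ω y := rfl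

/-- The composite prefixes a meridian with `ω` on `[0, 1/2]` and with the reversed `ω` on `[1/2,
3/4]`. At stage `s`, the homotopy follows `ω` up to parameter `s` and back during `[0, 3s/4]`,
turning at `t = s/2`, and then runs through the meridian on the remaining interval. -/
theorem wedgeSlide_symm_comp (ω : Path p q) :
    ((wedgeSlide (A := A) ω.symm).comp (wedgeSlide ω)).Homotopic (.id _) := by
  have hpos (z : I × (A × I)) : (4 : ℝ) - 3 * z.1 ≠ 0 := by linarith [z.1.2.2]
  let H : C(I × (A × I), Wedge X (Suspension A) p (Suspension.south A)) :=
    ⟨fun z => if (z.2.2 : ℝ) ≤ 3 / 4 * z.1 then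
        Wedge.inl _ _ (ω (clamp (min (2 * z.2.2) (3 * z.1 - 4 * z.2.2))))
      else Wedge.inr _ _ (Suspension.mk A (z.2.1, clamp ((4 * z.2.2 - 3 * z.1) / (4 - 3 * z.1)))), by
      refine Continuous.if_le (by fun_prop) ?_ (by fun_prop) (by fun_prop) ?_
      · have : Continuous fun z : I × (A × I) =>
            (4 * (z.2.2 : ℝ) - 3 * z.1) / (4 - 3 * (z.1 : ℝ)) :=
          Continuous.div (by fun_prop) (by fun_prop) hpos
        fun_prop
      · intro z hz
        rw [hz, clamp_of_nonpos (min_le_of_right_le (by linarith)), clamp_of_nonpos (le_of_eq _),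
          Suspension.mk_zero, ω.source, Wedge.glue]
        rw [div_eq_zero_iff]
        left; ring⟩
  have hH (s : I) (a : A) (t : I) : H (s, (a, t)) = if (t : ℝ) ≤ 3 / 4 * s then
      Wedge.inl _ _ (ω (clamp (min (2 * t) (3 * s - 4 * t))))
      else Wedge.inr _ _ (Suspension.mk A (a, clamp ((4 * t - 3 * s) / (4 - 3 * s)))) := rfl
  refine ContinuousMap.Homotopic.symm (Wedge.homotopic ((Wedge.inl _ _).comp .snd)
    (Suspension.homotopy H (.const I (Wedge.inl _ _ p))
      (.const I (Wedge.inr _ _ (Suspension.north A))) ?_ ?_)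
    (fun t => rfl) (fun x => rfl) (fun x => rfl) ?_ ?_)
  · intro s a
    have : (0 : ℝ) ≤ 3 / 4 * s := by linarith [s.2.1]
    rw [hH, Set.Icc.coe_zero, if_pos this, clamp_of_nonpos (min_le_of_left_le (by simp)),
      ω.source]
    rfl
  · intro s a
    have : ¬ (1 : ℝ) ≤ 3 / 4 * s := by linarith [s.2.2]
    rw [hH, Set.Icc.coe_one, if_neg this, clamp_of_one_le (le_of_eq _), Suspension.mk_one]
    · rfl
    · rw [mul_one, div_self (hpos (s, (a, 1)))]
  · refine fun y => Suspension.ind (fun a t => (hH 0 a t).trans ?_) (Wedge.glue _ _) rfl y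
    rw [Set.Icc.coe_zero]
    split_ifs with h
    · obtain rfl : t = 0 := Subtype.ext (le_antisymm (by simpa using h) t.2.1)
      rw [Suspension.mk_zero, clamp_of_nonpos (by simp), ω.source]
      exact Wedge.glue _ _
    · rw [clamp_eq (s := t) (by ring)]
      rfl
  · refine fun y => Suspension.ind (fun a t => (hH 1 a t).trans ?_) rfl rfl y
    rw [ContinuousMap.comp_apply, wedgeSlide_inr, slide_mk, Set.Icc.coe_one]
    by_cases h : (t : ℝ) ≤ 1 / 2
    · rw [if_pos h, if_pos (by linarith), wedgeSlide_inl, min_eq_left (by linarith)]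
    · rw [if_neg h, wedgeSlide_inr, slide_mk]
      have h1 : (clamp (2 * (t : ℝ) - 1) : ℝ) = 2 * t - 1 := by
        rw [coe_clamp, min_eq_right (by linarith [t.2.2]), max_eq_right (by linarith)]
      rw [h1]
      by_cases h' : (t : ℝ) ≤ 3 / 4
      · rw [if_pos (by linarith), if_pos (by linarith), min_eq_right (by linarith),
          Path.symm_apply]
        congr 2
        apply Subtype.ext
        rw [unitInterval.coe_symm_eq, coe_clamp, coe_clamp, min_eq_right (by linarith),
          min_eq_right (by linarith), max_eq_right (by linarith), max_eq_right (by linarith)]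
        ring
      · rw [if_neg (by linarith), if_neg (by linarith)]
        congr 4
        ring

/-- The homotopy type of `X ∨ ΣA` depends on the path component of the base point of `X` only. -/
theorem wedge_suspension_equiv_of_joined (h : Joined p q) :
    Nonempty (Wedge X (Suspension A) p (Suspension.south A) ≃ₕ
      Wedge X (Suspension A) q (Suspension.south A)) := by
  obtain ⟨ω⟩ := h
  refine ⟨⟨wedgeSlide ω, wedgeSlide ω.symm, wedgeSlide_symm_comp ω, ?_⟩⟩
  have := wedgeSlide_symm_comp (A := A) ω.symm
  rwa [Path.symm_symm] at this

end Slide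

/-! ### The unreduced and the reduced suspension -/

section Reduced

variable {A : Type u} [TopologicalSpace A] {x₀ : A}

/-- The suspension of `A` is pointed homotopy equivalent to the reduced suspension if the base point
has a neighbourhood `{w < 1}` that contracts to it in `A`. -/
theorem suspension_equiv_reduced (w : C(A, I)) (c : C(I × A, A)) (hw : w x₀ = 0)
    (hc₀ : ∀ a, c (0, a) = a) (hcx : ∀ s, c (s, x₀) = x₀) (hc₁ : ∀ a, w a ≠ 1 → c (1, a) = x₀) :
    ∃ (f : C(Suspension A, ReducedSuspension A x₀)) (g : C(ReducedSuspension A x₀, Suspension A)),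
      f (Suspension.south A) = ReducedSuspension.base x₀ ∧
      g (ReducedSuspension.base x₀) = Suspension.south A ∧
      (g.comp f).HomotopicRel (.id _) {Suspension.south A} ∧
      (f.comp g).HomotopicRel (.id _) {ReducedSuspension.base x₀} := by
  -- `k (r, (a, t))` runs up the meridian of `a` and down that of `x₀` to the height `1 - r`
  let k : C(I × (A × I), Suspension A) :=
    ⟨fun z => if (1 + z.1) * (z.2.2 : ℝ) ≤ 1 then
        Suspension.mk A (c (1, z.2.1), clamp (min ((1 + z.1) * z.2.2) (max (w z.2.1) (1 - z.1))))
      else Suspension.mk A (x₀, clamp (min (2 - (1 + z.1) * z.2.2) (max (w z.2.1) (1 - z.1)))), by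
      refine Continuous.if_le (by fun_prop) (by fun_prop) (by fun_prop) (by fun_prop) ?_
      intro z hz
      rw [hz]
      -- The two legs meet when `(1 + r) t = 1`. If `w a = 1`, both are at the north pole. Otherwise
      -- `c (1, a) = x₀`, so both lie on the meridian of `x₀` at the same height.
      by_cases h : w z.2.1 = 1
      · rw [h, clamp_of_one_le (by simp), clamp_of_one_le (by norm_num), Suspension.mk_one,
          Suspension.mk_one]
      · rw [hc₁ _ h]
        norm_num⟩
  have hk (r : I) (a : A) (t : I) : k (r, (a, t)) = if (1 + r) * (t : ℝ) ≤ 1 then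
        Suspension.mk A (c (1, a), clamp (min ((1 + r) * t) (max (w a) (1 - r))))
      else Suspension.mk A (x₀, clamp (min (2 - (1 + r) * t) (max (w a) (1 - r)))) := rfl
  have hk0 (r : I) (a : A) : k (r, (a, 0)) = Suspension.south A := by
    rw [hk, Set.Icc.coe_zero, mul_zero, if_pos zero_le_one,
      clamp_of_nonpos (min_le_of_left_le le_rfl), Suspension.mk_zero]
  have hk1 (r : I) (a : A) : k (r, (a, 1)) = Suspension.mk A (x₀, σ r) := by
    rw [hk, Set.Icc.coe_one, mul_one]
    split_ifs with h
    · obtain rfl : r = 0 := Subtype.ext (le_antisymm (by simpa using h) r.2.1)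
      rw [clamp_of_one_le (by simp), Suspension.mk_one, unitInterval.symm_zero, Suspension.mk_one]
    · rw [clamp_eq (s := σ r)]
      rw [unitInterval.coe_symm_eq, min_eq_left]
      · ring
      · exact le_max_of_le_right (by linarith)
  have hkx (r t : I) : ∃ t', k (r, (x₀, t)) = Suspension.mk A (x₀, t') := by
    rw [hk, hcx]
    split_ifs
    exacts [⟨_, rfl⟩, ⟨_, rfl⟩]
  have hk1x (t : I) : k (1, (x₀, t)) = Suspension.south A := by
    rw [hk, hcx, hw]
    split_ifs
    · rw [clamp_of_nonpos (by simp), Suspension.mk_zero]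
    · rw [clamp_of_nonpos (by simp), Suspension.mk_zero]
  have hk0' (a : A) (t : I) : k (0, (a, t)) = Suspension.mk A (c (1, a), t) := by
    rw [hk, if_pos (by simpa using t.2.2), clamp_eq (s := t)]
    have : (t : ℝ) ≤ max (w a) 1 := le_max_of_le_right t.2.2
    simpa using this
  let f : C(Suspension A, ReducedSuspension A x₀) := Suspension.lift (Collapse.proj _)
    (Collapse.base _) (Collapse.base _) (fun x => Collapse.proj_eq (Or.inr (Or.inl rfl)))
    (fun x => Collapse.proj_eq (Or.inr (Or.inr rfl)))
  have hfx (t : I) : f (Suspension.mk A (x₀, t)) = Collapse.base _ :=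
    Collapse.proj_eq (Or.inl rfl)
  -- At `r = 1` the height is capped by `w a`, which is `0` at `x₀`, and the second leg returns to
  -- the south pole. Hence `k (1, ·)` is constant on the collapsed set.
  let g : C(ReducedSuspension A x₀, Suspension A) := Collapse.lift
    ⟨fun z => k (1, z), by fun_prop⟩ (Suspension.south A) (by
      rintro ⟨a, t⟩ (h | h | h)
      · obtain rfl : a = x₀ := h
        exact hk1x t
      · obtain rfl : t = 0 := h
        exact hk0 1 a
      · obtain rfl : t = 1 := h
        refine (hk1 1 a).trans ?_
        rw [unitInterval.symm_one, Suspension.mk_zero])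
  let c' : C(I × (A × I), Suspension A) := (Suspension.mk A).comp
    ⟨fun z => (c (z.1, z.2.1), z.2.2), by fun_prop⟩
  let c₁ : C(Suspension A, Suspension A) := Suspension.lift
    ((Suspension.mk A).comp ⟨fun z => (c (1, z.1), z.2), by fun_prop⟩)
    (Suspension.south A) (Suspension.north A) (fun a => Suspension.mk_zero _)
    (fun a => Suspension.mk_one _)
  let c₁' : C(ReducedSuspension A x₀, ReducedSuspension A x₀) := Collapse.lift
    ((Collapse.proj _).comp ⟨fun z => (c (1, z.1), z.2), by fun_prop⟩) (Collapse.base _) (by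
      rintro ⟨a, t⟩ (h | h | h)
      · obtain rfl : a = x₀ := h
        exact Collapse.proj_eq (Or.inl (hcx 1))
      · exact Collapse.proj_eq (Or.inr (Or.inl h))
      · exact Collapse.proj_eq (Or.inr (Or.inr h)))
  refine ⟨f, g, rfl, rfl, ?_, ?_⟩
  -- Both composites are compared with the map induced by `c (1, ·)`, through `k`. That map is
  -- homotopic to the identity through `c`.
  · refine ContinuousMap.HomotopicRel.trans (g := c₁) ?_ (ContinuousMap.HomotopicRel.symm ?_)
    · refine ContinuousMap.HomotopicRel.symm (Suspension.homotopicRel k (Suspension.south A)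
        ((Suspension.mk A).comp ⟨fun r => (x₀, σ r), by fun_prop⟩) hk0 hk1
        (fun z => hk0' z.1 z.2) (fun z => rfl) rfl rfl ?_ ?_)
      · refine Eq.symm ((congrArg (Suspension.mk A) ?_).trans (Suspension.mk_one x₀))
        exact Prod.ext rfl unitInterval.symm_zero
      · refine Eq.symm ((congrArg (Suspension.mk A) ?_).trans (Suspension.mk_zero x₀))
        exact Prod.ext rfl unitInterval.symm_one
    · exact Suspension.homotopicRel c' (Suspension.south A) (.const I (Suspension.north A))
        (fun t a => Suspension.mk_zero _) (fun t a => Suspension.mk_one _)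
        (fun z => congrArg (Suspension.mk A) (Prod.ext (hc₀ _) rfl)) (fun z => rfl)
        rfl rfl rfl rfl
  · refine ContinuousMap.HomotopicRel.trans (g := c₁') ?_ (ContinuousMap.HomotopicRel.symm ?_)
    · refine ContinuousMap.HomotopicRel.symm (Collapse.homotopicRel (f.comp k) (Collapse.base _)
        ?_ ?_ (fun z => rfl) rfl rfl)
      · rintro r ⟨a, t⟩ (h | h | h)
        · obtain rfl : a = x₀ := h
          obtain ⟨t', ht'⟩ := hkx r t
          rw [ContinuousMap.comp_apply, ht', hfx]
        · obtain rfl : t = 0 := h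
          rw [ContinuousMap.comp_apply, hk0]
          rfl
        · obtain rfl : t = 1 := h
          rw [ContinuousMap.comp_apply, hk1, hfx]
      · rintro ⟨a, t⟩
        rw [ContinuousMap.comp_apply, hk0']
        rfl
    · refine Collapse.homotopicRel ((Collapse.proj _).comp
        ⟨fun z => (c (z.1, z.2.1), z.2.2), by fun_prop⟩) (Collapse.base _) ?_ ?_ (fun z => rfl)
        rfl rfl
      · rintro r ⟨a, t⟩ (h | h | h)
        · obtain rfl : a = x₀ := h
          exact Collapse.proj_eq (Or.inl (hcx r))
        · exact Collapse.proj_eq (Or.inr (Or.inl h))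
        · exact Collapse.proj_eq (Or.inr (Or.inr h))
      · exact fun z => congrArg (Collapse.proj _) (Prod.ext (hc₀ _) rfl)

end Reduced

/-! ### Geometry of realizations -/

/-- `x` is a point of the simplex spanned by `s`, in barycentric coordinates. -/
def IsPoint {P : Type u} (s : Finset P) (x : P → ℝ) : Prop :=
  (∀ a ∈ s, 0 ≤ x a) ∧ (∀ a, a ∉ s → x a = 0) ∧ ∑ a ∈ s, x a = 1

namespace IsPoint

variable {P : Type u} {s t : Finset P} {x y : P → ℝ}

theorem nonneg (h : IsPoint s x) (a : P) : 0 ≤ x a := by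
  by_cases ha : a ∈ s
  exacts [h.1 a ha, (h.2.1 a ha).ge]

theorem sum_eq_of_subset (h : IsPoint s x) (hst : s ⊆ t) : ∑ a ∈ t, x a = 1 := by
  rw [← h.2.2]
  exact (Finset.sum_subset hst fun a _ ha => h.2.1 a ha).symm

theorem of_sum_eq (h0 : ∀ a, 0 ≤ x a) (hs : ∀ a, a ∉ s → x a = 0) (hst : s ⊆ t)
    (ht : ∑ a ∈ t, x a = 1) : IsPoint s x :=
  ⟨fun a _ => h0 a, hs, by rw [← ht]; exact Finset.sum_subset hst fun a _ ha => hs a ha⟩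

theorem mono (h : IsPoint s x) (hst : s ⊆ t) : IsPoint t x :=
  ⟨fun a _ => h.nonneg a, fun a ha => h.2.1 a fun h' => ha (hst h'), h.sum_eq_of_subset hst⟩

theorem le_one (h : IsPoint s x) (a : P) : x a ≤ 1 := by
  by_cases ha : a ∈ s
  · rw [← h.2.2]
    exact Finset.single_le_sum h.1 ha
  · rw [h.2.1 a ha]
    exact zero_le_one

theorem convex (hx : IsPoint s x) (hy : IsPoint s y) (r : I) :
    IsPoint s fun a => (1 - r) * x a + r * y a := by
  refine ⟨fun a ha => ?_, fun a ha => ?_, ?_⟩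
  · exact add_nonneg (mul_nonneg (sub_nonneg.2 r.2.2) (hx.1 a ha)) (mul_nonneg r.2.1 (hy.1 a ha))
  · simp [hx.2.1 a ha, hy.2.1 a ha]
  · rw [Finset.sum_add_distrib, ← Finset.mul_sum, ← Finset.mul_sum, hx.2.2, hy.2.2]
    ring

theorem single [DecidableEq P] {p : P} (hp : p ∈ s) :
    IsPoint s fun a => if a = p then (1 : ℝ) else 0 :=
  ⟨fun a _ => by dsimp only; split_ifs <;> simp, fun a ha => if_neg fun h => ha (by rwa [h]), by
    rw [Finset.sum_ite_eq' s p]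
    exact if_pos hp⟩

end IsPoint

namespace Realization

variable {P : Type u} {X : PreAbstractSimplicialComplex P}

theorem exists_isPoint (x : Realization X) : ∃ s ∈ X.faces, IsPoint s x.1 := x.2

theorem nonneg (x : Realization X) (a : P) : 0 ≤ x.1 a :=
  let ⟨_, _, h⟩ := x.exists_isPoint
  h.nonneg a

theorem le_one (x : Realization X) (a : P) : x.1 a ≤ 1 :=
  let ⟨_, _, h⟩ := x.exists_isPoint
  h.le_one a

theorem continuous_apply (a : P) : Continuous fun x : Realization X => x.1 a :=
  (_root_.continuous_apply a).comp continuous_subtype_val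

theorem continuous_mk {Z : Type*} [TopologicalSpace Z] (f : Z → P → ℝ) (hf : Continuous f)
    (h : ∀ z, ∃ s ∈ X.faces, IsPoint s (f z)) :
    Continuous fun z => (⟨f z, h z⟩ : Realization X) :=
  hf.subtype_mk h

/-- Each closed simplex is closed in a product of unit intervals, hence compact, and there are
finitely many simplices. -/
theorem compactSpace (hX : X.faces.Finite) : CompactSpace (Realization X) := by
  have hK (s : Finset P) : IsCompact {x : P → ℝ | IsPoint s x} := by
    refine (isCompact_univ_pi fun _ : P => isCompact_Icc (a := (0 : ℝ)) (b := 1)).of_isClosed_subset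
      ?_ fun x hx a _ => ⟨IsPoint.nonneg hx a, IsPoint.le_one hx a⟩
    have h₁ : IsClosed {x : P → ℝ | ∀ a ∈ s, 0 ≤ x a} := by
      simp only [Set.ofPred_forall]
      exact isClosed_iInter fun a => isClosed_iInter fun _ =>
        isClosed_le continuous_const (_root_.continuous_apply a)
    have h₂ : IsClosed {x : P → ℝ | ∀ a, a ∉ s → x a = 0} := by
      simp only [Set.ofPred_forall]
      exact isClosed_iInter fun a => isClosed_iInter fun _ =>
        isClosed_eq (_root_.continuous_apply a) continuous_const
    exact h₁.inter (h₂.inter (isClosed_eq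
      (continuous_finsetSum _ fun a _ => _root_.continuous_apply a) continuous_const))
  have h : IsCompact {x : P → ℝ | ∃ s ∈ X.faces, IsPoint s x} := by
    convert hX.isCompact_biUnion fun s _ => hK s
    ext x
    simp
  exact isCompact_iff_compactSpace.1 h

/-- Two points of one simplex are joined by a path. -/
theorem joined {s : Finset P} (hs : s ∈ X.faces) {x y : Realization X} (hx : IsPoint s x.1)
    (hy : IsPoint s y.1) : Joined x y := by
  refine ⟨⟨⟨fun r => ⟨fun a => (1 - r) * x.1 a + r * y.1 a, s, hs, hx.convex hy r⟩, ?_⟩, ?_, ?_⟩⟩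
  · exact continuous_mk _ (by fun_prop) _
  · exact Subtype.ext (funext fun a => by simp)
  · exact Subtype.ext (funext fun a => by simp)

variable [DecidableEq P]

/-- A vertex, as a point of the realization. -/
def vertex (p : P) (hp : {p} ∈ X.faces) : Realization X :=
  ⟨fun a => if a = p then 1 else 0, {p}, hp, IsPoint.single (Finset.mem_singleton_self p)⟩

theorem isPoint_vertex {p : P} (hp : {p} ∈ X.faces) {s : Finset P} (h : p ∈ s) :
    IsPoint s (vertex p hp).1 := IsPoint.single h

theorem joined_vertex (x : Realization X) : ∃ (p : P) (hp : {p} ∈ X.faces),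
    Joined x (vertex p hp) := by
  obtain ⟨s, hs, hx⟩ := x.exists_isPoint
  obtain ⟨p, hp⟩ := (X.isRelLowerSet_faces hs).1
  exact ⟨p, (X.isRelLowerSet_faces hs).2 (Finset.singleton_subset_iff.2 hp)
    (Finset.singleton_nonempty p), joined hs hx (isPoint_vertex _ hp)⟩

theorem joined_vertex_vertex {p q : P} (hp : {p} ∈ X.faces) (hq : {q} ∈ X.faces)
    (h : {p, q} ∈ X.faces) : Joined (vertex p hp) (vertex q hq) :=
  joined h (isPoint_vertex _ (by simp)) (isPoint_vertex _ (by simp))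

/-- The realization of a cone is contractible. -/
theorem contractibleSpace_cone (p : P) (A : PreAbstractSimplicialComplex P) :
    ContractibleSpace (Realization (cone p A)) := by
  have hp : {p} ∈ (cone p A).faces := Or.inr (Or.inl rfl)
  rw [contractible_iff_id_nullhomotopic]
  refine ⟨vertex p hp, ⟨⟨⟨fun z => ⟨fun a => (1 - z.1) * z.2.1 a + z.1 * (vertex p hp).1 a, ?_⟩, ?_⟩,
    ?_, ?_⟩⟩⟩
  · obtain ⟨s, hs, hx⟩ := z.2.exists_isPoint
    refine ⟨insert p s, ?_, (hx.mono (Finset.subset_insert p s)).convex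
      (isPoint_vertex hp (Finset.mem_insert_self p s)) z.1⟩
    rcases hs with hs | rfl | ⟨t, ht, rfl⟩
    · exact Or.inr (Or.inr ⟨s, hs, rfl⟩)
    · simpa using hp
    · exact Or.inr (Or.inr ⟨t, ht, Finset.insert_idem p t⟩)
  · refine continuous_mk _ (continuous_pi fun a => ?_) _
    have := (continuous_apply a).comp
          (continuous_snd : Continuous (Prod.snd : I × Realization (cone p A) → _))
    simp only [Function.comp_def] at this
    fun_prop
  · exact fun x => Subtype.ext (funext fun a => by simp)
  · exact fun x => Subtype.ext (funext fun a => by simp)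

/-- A point of a realization has a neighbourhood that contracts to it. -/
theorem exists_contraction (x₀ : Realization X) :
    ∃ (w : C(Realization X, I)) (c : C(I × Realization X, Realization X)), w x₀ = 0 ∧
      (∀ a, c (0, a) = a) ∧ (∀ s, c (s, x₀) = x₀) ∧ ∀ a, w a ≠ 1 → c (1, a) = x₀ := by
  obtain ⟨s₀, hs₀, h₀⟩ := x₀.exists_isPoint
  -- `s` is the support of `x₀`. The product `l` is non-zero only in the open star of `s`, where `x`
  -- and `x₀` lie in a common simplex, and it equals `1` at `x₀`.
  let s := s₀.filter fun a => x₀.1 a ≠ 0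
  let l : C(Realization X, I) := ⟨fun x => ∏ a ∈ s, clamp (x.1 a / x₀.1 a),
    continuous_finsetProd _ fun a _ =>
      continuous_clamp.comp ((continuous_apply a).div_const _)⟩
  have hl₀ : l x₀ = 1 := Finset.prod_eq_one fun a ha => by
    rw [div_self (Finset.mem_filter.1 ha).2, clamp_of_one_le le_rfl]
  have hl (x : Realization X) (hx : l x ≠ 0) : ∃ t ∈ X.faces, IsPoint t x.1 ∧ IsPoint t x₀.1 := by
    obtain ⟨t, ht, hxt⟩ := x.exists_isPoint
    have hst : s ⊆ t := fun a ha => by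
      by_contra hat
      refine hx (Finset.prod_eq_zero ha ?_)
      rw [hxt.2.1 a hat, zero_div, clamp_of_nonpos le_rfl]
    refine ⟨t, ht, hxt, fun a _ => x₀.nonneg a, fun a ha => ?_, ?_⟩
    · by_contra h
      exact ha (hst (Finset.mem_filter.2 ⟨by_contra fun h' => h (h₀.2.1 a h'), h⟩))
    · refine Eq.trans ?_ h₀.2.2
      refine (Finset.sum_subset hst fun a ha has => ?_).symm.trans (Finset.sum_filter_ne_zero s₀)
      by_contra h
      exact has (Finset.mem_filter.2 ⟨by_contra fun h' => h (h₀.2.1 a h'), h⟩)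
  -- Points move on the segment towards `x₀`. The factor `clamp (2 * l)` stops the motion outside
  -- the star and is `1` for `l ≥ 1/2`, so that points with `w ≠ 1` reach `x₀`.
  let c : C(I × Realization X, Realization X) :=
    ⟨fun z => ⟨fun a => (1 - ((z.1 * clamp (2 * l z.2) : I) : ℝ)) * z.2.1 a +
      ((z.1 * clamp (2 * l z.2) : I) : ℝ) * x₀.1 a, by
        by_cases h : l z.2 = 0
        · obtain ⟨t, ht, hxt⟩ := z.2.exists_isPoint
          refine ⟨t, ht, ?_⟩
          rw [h, clamp_of_nonpos (by simp)]
          simpa [IsPoint] using hxt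
        · obtain ⟨t, ht, hxt, hx₀⟩ := hl z.2 h
          exact ⟨t, ht, hxt.convex hx₀ _⟩⟩, by
      refine continuous_mk _ (continuous_pi fun a => ?_) _
      have := (continuous_apply a).comp
          (continuous_snd : Continuous (Prod.snd : I × Realization X → _))
      simp only [Function.comp_def] at this
      fun_prop⟩
  have hc (r : I) (x : Realization X) (a : P) : (c (r, x)).1 a =
      (1 - r * (clamp (2 * l x) : I)) * x.1 a + r * (clamp (2 * l x) : I) * x₀.1 a := rfl
  refine ⟨⟨fun x => clamp (2 * (1 - l x)), by fun_prop⟩, c, ?_, fun x => ?_, fun r => ?_,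
    fun x hx => ?_⟩
  · exact clamp_of_nonpos (by simp [hl₀])
  · exact Subtype.ext (funext fun a => by simp [hc])
  · exact Subtype.ext (funext fun a => by rw [hc]; ring)
  · have h : 1 ≤ 2 * (l x : ℝ) := by
      by_contra h
      exact hx (clamp_of_one_le (by linarith))
    exact Subtype.ext (funext fun a => by simp [hc, clamp_of_one_le h])

end Realization

/-! ### A full subcomplex whose cone is contained in the complex -/

/-- `A` is a full finite subcomplex of `X` with vertex set `B`, and `X` contains the cone over `A`
with apex `p ∉ B`. -/
structure IsConePair {P : Type u} [DecidableEq P] (A X : PreAbstractSimplicialComplex P) (p : P)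
    (B : Finset P) : Prop where
  finite : A.faces.Finite
  cone_le : cone p A ≤ X
  subset : ∀ s ∈ A.faces, s ⊆ B
  full : ∀ s ∈ X.faces, s ⊆ B → s ∈ A.faces
  notMem : p ∉ B

namespace IsConePair

variable {P : Type u} [DecidableEq P] {A X : PreAbstractSimplicialComplex P} {p : P} {B : Finset P}

/-! ### The deformation of a neighbourhood of the cone into the cone. -/

/-- The part of the mass of a point that lies on `B`. -/
def mass (B : Finset P) (x : P → ℝ) : ℝ := ∑ q ∈ B, x q

/-- The part of the mass of a point that lies outside the cone. -/
def outer (p : P) (B : Finset P) (x : P → ℝ) : ℝ := 1 - x p - mass B x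

omit [DecidableEq P] in
@[fun_prop]
theorem continuous_mass : Continuous (mass B) := continuous_finsetSum _ fun q _ => continuous_apply q

omit [DecidableEq P] in
@[fun_prop]
theorem continuous_outer : Continuous (outer p B) := by
  unfold outer
  fun_prop

/-- The scaling factor for coordinates on the cone. -/
noncomputable def innerScale (r u : ℝ) : ℝ := 1 - r + r / max (1 - u) (1 / 2)

/-- The scaling factor for coordinates outside the cone. -/
noncomputable def outerScale (r u : ℝ) : ℝ := 1 - r + r * max 0 (2 * u - 1) / max u (1 / 2)

/-- For `l = 0`, the deformation that pushes a neighbourhood of the cone into the cone. On points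
that have been pushed into the cone at `r = 1`, the contraction of the cone to its apex, with
parameter `l`. -/
noncomputable def push (p : P) (B : Finset P) (r l : ℝ) (x : P → ℝ) (q : P) : ℝ :=
  if q = p then innerScale r (outer p B x) * (x p + l * mass B x)
  else if q ∈ B then innerScale r (outer p B x) * (1 - l) * x q
  else outerScale r (outer p B x) * x q

/-- This keeps the total mass equal to `1`, as the cone coordinates have mass `1 - u` and the others
`u`. At `r = 1` the outer mass becomes `max 0 (2u - 1)`, so exactly the points with `u ≤ 1/2` arrive
in the cone, and no denominator falls below `1/2`. -/
theorem scale_add {r u : ℝ} : innerScale r u * (1 - u) + outerScale r u * u = 1 := by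
  unfold innerScale outerScale
  rcases le_total u (1 / 2) with h | h
  · rw [max_eq_left (a := 1 - u) (by linarith), max_eq_left (a := 0) (by linarith)]
    have : 1 - u ≠ 0 := by linarith
    field_simp
    ring
  · rw [max_eq_right (a := 1 - u) (by linarith), max_eq_right (a := 0) (by linarith),
      max_eq_left (a := u) h]
    have : u ≠ 0 := by linarith
    field_simp
    ring

theorem innerScale_nonneg {r u : ℝ} (hr0 : 0 ≤ r) (hr1 : r ≤ 1) : 0 ≤ innerScale r u := by
  have : (0 : ℝ) < max (1 - u) (1 / 2) := lt_max_of_lt_right (by norm_num)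
  exact add_nonneg (by linarith) (by positivity)

theorem outerScale_nonneg {r u : ℝ} (hr0 : 0 ≤ r) (hr1 : r ≤ 1) : 0 ≤ outerScale r u := by
  have : (0 : ℝ) < max u (1 / 2) := lt_max_of_lt_right (by norm_num)
  exact add_nonneg (by linarith) (by positivity)

theorem outerScale_one {u : ℝ} (hu : u ≤ 1 / 2) : outerScale 1 u = 0 := by
  rw [outerScale, max_eq_left (by linarith)]
  simp

theorem innerScale_zero (r : ℝ) : innerScale r 0 = 1 := by
  rw [innerScale, max_eq_left (by norm_num)]
  ring

@[fun_prop]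
theorem continuous_push {Z : Type*} [TopologicalSpace Z] {r l : Z → ℝ} {x : Z → P → ℝ}
    (hr : Continuous r) (hl : Continuous l) (hx : Continuous x) :
    Continuous fun z => push p B (r z) (l z) (x z) := by
  have h1 (u : ℝ) : max (1 - u) (1 / 2) ≠ 0 := (lt_max_of_lt_right (by norm_num)).ne'
  have h2 (u : ℝ) : max u (1 / 2) ≠ 0 := (lt_max_of_lt_right (by norm_num)).ne'
  have hi : Continuous fun z => innerScale (r z) (outer p B (x z)) := by
    unfold innerScale
    exact Continuous.add (by fun_prop) (Continuous.div (by fun_prop) (by fun_prop) fun _ => h1 _)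
  have ho : Continuous fun z => outerScale (r z) (outer p B (x z)) := by
    unfold outerScale
    exact Continuous.add (by fun_prop) (Continuous.div (by fun_prop) (by fun_prop) fun _ => h2 _)
  refine continuous_pi fun q => ?_
  unfold push
  split_ifs <;> fun_prop

variable (h : IsConePair A X p B)
include h

theorem le : A ≤ X := (le_cone p A).trans h.cone_le

theorem apex_mem : {p} ∈ X.faces := h.cone_le (Or.inr (Or.inl rfl))

theorem ne_apex {q : P} (hq : q ∈ B) : q ≠ p := by
  rintro rfl
  exact h.notMem hq

theorem sum_insert_union (t : Finset P) (f : P → ℝ) :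
    ∑ q ∈ insert p (B ∪ t), f q = f p + mass B f + ∑ q ∈ t \ insert p B, f q := by
  rw [mass, ← Finset.sum_insert h.notMem, ← Finset.sum_union Finset.disjoint_sdiff,
    Finset.union_sdiff_self_eq_union, Finset.insert_union]

theorem outer_eq {t : Finset P} {x : P → ℝ} (hx : IsPoint t x) :
    outer p B x = ∑ q ∈ t \ insert p B, x q := by
  have := hx.sum_eq_of_subset (t := insert p (B ∪ t))
    (Finset.subset_union_right.trans (Finset.subset_insert _ _))
  rw [h.sum_insert_union] at this
  rw [outer]
  linarith

theorem outer_nonneg (x : Realization X) : 0 ≤ outer p B x.1 := by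
  obtain ⟨t, -, hx⟩ := x.exists_isPoint
  rw [h.outer_eq hx]
  exact Finset.sum_nonneg fun q _ => hx.nonneg q

omit h [DecidableEq P] in
theorem mass_nonneg (x : Realization X) : 0 ≤ mass B x.1 :=
  Finset.sum_nonneg fun q _ => x.nonneg q

theorem mass_le_one (x : Realization X) : mass B x.1 ≤ 1 := by
  have := h.outer_nonneg x
  have := x.nonneg p
  unfold outer at *
  linarith

theorem eq_zero_of_outer {x : Realization X} (hx : outer p B x.1 = 0) {q : P} (hq : q ≠ p)
    (hqB : q ∉ B) : x.1 q = 0 := by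
  obtain ⟨t, -, ht⟩ := x.exists_isPoint
  by_cases hqt : q ∈ t
  · rw [h.outer_eq ht, Finset.sum_eq_zero_iff_of_nonneg fun q _ => ht.nonneg q] at hx
    exact hx q (by simp [hqt, hq, hqB])
  · exact ht.2.1 q hqt

theorem mass_push (r l : ℝ) (x : P → ℝ) :
    mass B (push p B r l x) = innerScale r (outer p B x) * (1 - l) * mass B x := by
  rw [mass, mass, Finset.mul_sum]
  refine Finset.sum_congr rfl fun q hq => ?_
  rw [push, if_neg (h.ne_apex hq), if_pos hq]

/-- For `l = 0` coordinates are only rescaled, so the point stays in its simplex `t`. For `l ≠ 0`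
mass moves from `B` to `p`, which need not span a simplex with `t`. Hence the requirement that the
point has already reached the cone: its support is then in `p * (t ∩ B)`, a simplex by fullness of
`A`. -/
theorem push_isPoint (x : Realization X) {r l : ℝ} (hr0 : 0 ≤ r) (hr1 : r ≤ 1)
    (hl0 : 0 ≤ l) (hl1 : l ≤ 1) (hl : l ≠ 0 → r = 1 ∧ outer p B x.1 ≤ 1 / 2) :
    ∃ s ∈ X.faces, IsPoint s (push p B r l x.1) := by
  obtain ⟨t, ht, hx⟩ := x.exists_isPoint
  have hi := innerScale_nonneg (u := outer p B x.1) hr0 hr1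
  have ho := outerScale_nonneg (u := outer p B x.1) hr0 hr1
  have h0 (q : P) : 0 ≤ push p B r l x.1 q := by
    have := mass_nonneg (B := B) x
    have := x.nonneg q
    have := x.nonneg p
    have : 0 ≤ 1 - l := by linarith
    unfold push
    split_ifs <;> positivity
  have hsum : ∑ q ∈ insert p (B ∪ t), push p B r l x.1 q = 1 := by
    have h2 : ∑ q ∈ t \ insert p B, push p B r l x.1 q =
        outerScale r (outer p B x.1) * outer p B x.1 := by
      rw [h.outer_eq hx, Finset.mul_sum]
      refine Finset.sum_congr rfl fun q hq => ?_
      rw [Finset.mem_sdiff, Finset.mem_insert, not_or] at hq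
      rw [push, if_neg hq.2.1, if_neg hq.2.2, h.outer_eq hx]
    rw [h.sum_insert_union, h.mass_push, h2, push, if_pos rfl]
    refine Eq.trans ?_ (scale_add (r := r) (u := outer p B x.1))
    have : x.1 p = 1 - outer p B x.1 - mass B x.1 := by rw [outer]; ring
    rw [this]
    ring
  by_cases hl' : l = 0
  · refine ⟨t, ht, IsPoint.of_sum_eq h0 (fun q hq => ?_)
      (Finset.subset_union_right.trans (Finset.subset_insert _ _)) hsum⟩
    have := hx.2.1 q hq
    unfold push
    split_ifs with hqp
    · rw [← hqp, this, hl']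
      ring
    · rw [this, mul_zero]
    · rw [this, mul_zero]
  · obtain ⟨rfl, hu⟩ := hl hl'
    refine ⟨insert p (t ∩ B), ?_, IsPoint.of_sum_eq h0 (fun q hq => ?_)
      (Finset.insert_subset_insert _ (Finset.inter_subset_right.trans Finset.subset_union_left))
      hsum⟩
    · rcases (t ∩ B).eq_empty_or_nonempty with he | hne
      · rw [he]
        exact h.apex_mem
      · exact h.cone_le (Or.inr (Or.inr ⟨t ∩ B, h.full _ ((X.isRelLowerSet_faces ht).2
          Finset.inter_subset_left hne) Finset.inter_subset_right, rfl⟩))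
    · rw [Finset.mem_insert, not_or, Finset.mem_inter] at hq
      rw [push, if_neg hq.1]
      split_ifs with hqB
      · rw [hx.2.1 q fun hqt => hq.2 ⟨hqt, hqB⟩, mul_zero]
      · rw [outerScale_one hu, zero_mul]

/-- The deformation with `l = 0` is stationary on the cone, in particular on `A`. -/
theorem push_eq_self {x : Realization X} (hx : outer p B x.1 = 0) (r : ℝ) :
    push p B r 0 x.1 = x.1 := by
  funext q
  unfold push
  split_ifs with hqp hqB
  · rw [hx, innerScale_zero, hqp]
    ring
  · rw [hx, innerScale_zero]
    ring
  · rw [h.eq_zero_of_outer hx hqp hqB, mul_zero]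

omit h in
theorem push_zero_zero (x : Realization X) : push p B 0 0 x.1 = x.1 := by
  funext q
  unfold push innerScale outerScale
  split_ifs with hqp hqB
  · rw [hqp]
    ring
  · ring
  · ring

theorem push_one_one (x : Realization X) (hu : outer p B x.1 ≤ 1 / 2) :
    push p B 1 1 x.1 = (Realization.vertex p h.apex_mem).1 := by
  have h1 := scale_add (r := 1) (u := outer p B x.1)
  rw [outerScale_one hu, zero_mul, add_zero] at h1
  have h2 : x.1 p + 1 * mass B x.1 = 1 - outer p B x.1 := by
    rw [outer]
    ring
  funext q
  unfold push
  split_ifs with hqp hqB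
  · rw [h2, h1, Realization.vertex, hqp]
    simp
  · simp [Realization.vertex, hqp]
  · rw [outerScale_one hu]
    simp [Realization.vertex, hqp]

theorem mass_apex : mass B (Realization.vertex p h.apex_mem).1 = 0 :=
  Finset.sum_eq_zero fun _ hq => if_neg (h.ne_apex hq)

theorem outer_apex : outer p B (Realization.vertex p h.apex_mem).1 = 0 := by
  rw [outer, h.mass_apex]
  simp [Realization.vertex]

theorem push_apex (r l : ℝ) : push p B r l (Realization.vertex p h.apex_mem).1 =
    (Realization.vertex p h.apex_mem).1 := by
  conv_rhs => rw [← h.push_eq_self h.outer_apex r]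
  funext q
  unfold push
  rw [h.mass_apex]
  split_ifs with hqp hqB
  · ring
  · have : (Realization.vertex p h.apex_mem).1 q = 0 := if_neg hqp
    rw [this]
    ring
  · rfl

theorem isPoint_restrict {t : Finset P} (ht : t ∈ A.faces) {x : P → ℝ} (hx : IsPoint t x) :
    mass B x = 1 ∧ x p = 0 :=
  ⟨hx.sum_eq_of_subset (h.subset t ht), hx.2.1 p fun hp => h.notMem (h.subset t ht hp)⟩

theorem mass_of_mem (x : Realization A) : mass B x.1 = 1 :=
  let ⟨_, ht, hx⟩ := x.exists_isPoint
  (h.isPoint_restrict ht hx).1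

theorem apex_of_mem (x : Realization A) : x.1 p = 0 :=
  let ⟨_, ht, hx⟩ := x.exists_isPoint
  (h.isPoint_restrict ht hx).2

theorem eq_zero_of_mem (x : Realization A) {q : P} (hq : q ∉ B) : x.1 q = 0 := by
  obtain ⟨t, ht, hx⟩ := x.exists_isPoint
  exact hx.2.1 q fun hqt => hq (h.subset t ht hqt)

theorem outer_of_mem (x : Realization A) : outer p B x.1 = 0 := by
  rw [outer, h.mass_of_mem, h.apex_of_mem]
  ring

/-! #### The suspension as a subspace of a vector space -/

omit h [DecidableEq P] in
/-- Coordinates on the suspension. -/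
noncomputable def _root_.MorseMatching.suspensionCoord (A : PreAbstractSimplicialComplex P) :
    C(Suspension (Realization A), ℝ × (P → ℝ)) :=
  -- The factor `t (1 - t)` makes the second coordinate vanish exactly at the poles. Elsewhere it
  -- can be divided out to recover the point of `A`.
  Suspension.lift ⟨fun z => ((z.2 : ℝ), fun q => z.2 * (1 - z.2) * z.1.1 q), by
      refine Continuous.prodMk (by fun_prop) (continuous_pi fun q => ?_)
      have := (Realization.continuous_apply q).comp
        (continuous_fst : Continuous (Prod.fst : Realization A × I → _))
      simp only [Function.comp_def] at this
      fun_prop⟩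
    (0, 0) (1, 0) (fun x => by ext <;> simp) (fun x => by ext <;> simp)

omit h [DecidableEq P] in
theorem _root_.MorseMatching.suspensionCoord_mk (x : Realization A) (t : I) :
    suspensionCoord A (Suspension.mk _ (x, t)) = ((t : ℝ), fun q => t * (1 - t) * x.1 q) := rfl

omit h [DecidableEq P] in
theorem _root_.MorseMatching.suspensionCoord_injective :
    Function.Injective (suspensionCoord A) := by
  have hS : suspensionCoord A (Suspension.south _) = (0, 0) := rfl
  have hN : suspensionCoord A (Suspension.north _) = (1, 0) := rfl
  have h0 (x : Realization A) (t : I) (ht : (t : ℝ) = 0) :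
      Suspension.mk _ (x, t) = Suspension.south _ := by
    rw [show t = 0 from Subtype.ext ht, Suspension.mk_zero]
  have h1 (x : Realization A) (t : I) (ht : (t : ℝ) = 1) :
      Suspension.mk _ (x, t) = Suspension.north _ := by
    rw [show t = 1 from Subtype.ext ht, Suspension.mk_one]
  intro y z
  induction y using Suspension.ind with
  | h x t =>
    induction z using Suspension.ind with
    | h x' t' =>
      intro hyz
      rw [suspensionCoord_mk, suspensionCoord_mk, Prod.mk.injEq] at hyz
      obtain ⟨hy, hz⟩ := hyz
      obtain rfl : t = t' := Subtype.ext hy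
      by_cases ht0 : (t : ℝ) = 0
      · rw [h0 x t ht0, h0 x' t ht0]
      by_cases ht1 : (t : ℝ) = 1
      · rw [h1 x t ht1, h1 x' t ht1]
      have : x = x' := Subtype.ext (funext fun q =>
        mul_left_cancel₀ (mul_ne_zero ht0 (sub_ne_zero.2 (Ne.symm ht1))) (congrFun hz q))
      rw [this]
    | hs => exact fun hyz => h0 x t (congrArg Prod.fst hyz)
    | hn => exact fun hyz => h1 x t (congrArg Prod.fst hyz)
  | hs =>
    induction z using Suspension.ind with
    | h x t => exact fun hyz => (h0 x t (congrArg Prod.fst hyz).symm).symm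
    | hs => exact fun _ => rfl
    | hn => exact fun hyz => absurd (congrArg Prod.fst hyz) zero_ne_one
  | hn =>
    induction z using Suspension.ind with
    | h x t => exact fun hyz => (h1 x t (congrArg Prod.fst hyz).symm).symm
    | hs => exact fun hyz => absurd (congrArg Prod.fst hyz) one_ne_zero
    | hn => exact fun _ => rfl

-- The suspension is compact because `A` is finite, and an injective continuous map from a compact
-- space to a Hausdorff space is an embedding. Continuity of maps into the suspension can thus be
-- checked in coordinates.
omit h [DecidableEq P] in
theorem _root_.MorseMatching.isInducing_suspensionCoord (hA : A.faces.Finite) :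
    Topology.IsInducing (suspensionCoord A) := by
  have := Realization.compactSpace hA
  have : CompactSpace (Suspension (Realization A)) :=
    inferInstanceAs (CompactSpace (Quot (SuspensionRel (Realization A))))
  exact ((suspensionCoord A).continuous.isClosedEmbedding suspensionCoord_injective).isInducing

/-! ### The projection of `X` to the suspension of `A`. -/

theorem exists_normalize (x : Realization X) (hx : mass B x.1 ≠ 0) :
    ∃ z : Realization A, ∀ q ∈ B, z.1 q = x.1 q / mass B x.1 := by
  obtain ⟨t, ht, hxt⟩ := x.exists_isPoint
  have hm : ∑ q ∈ B, (if q ∈ B then x.1 q / mass B x.1 else 0) = 1 := by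
    rw [Finset.sum_congr rfl fun q hq => if_pos hq, ← Finset.sum_div]
    exact div_self hx
  have hne : (t ∩ B).Nonempty := by
    by_contra he
    rw [Finset.not_nonempty_iff_eq_empty] at he
    refine hx (Finset.sum_eq_zero fun q hq => hxt.2.1 q fun hqt => ?_)
    have : q ∈ t ∩ B := Finset.mem_inter.2 ⟨hqt, hq⟩
    rw [he] at this
    exact absurd this (Finset.notMem_empty q)
  -- The restriction to `B` is supported on `t ∩ B`, a simplex of `A` by fullness.
  refine ⟨⟨fun q => if q ∈ B then x.1 q / mass B x.1 else 0, t ∩ B,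
    h.full _ ((X.isRelLowerSet_faces ht).2 Finset.inter_subset_left hne) Finset.inter_subset_right,
    IsPoint.of_sum_eq (t := B) (fun q => ?_) (fun q hq => ?_) Finset.inter_subset_right hm⟩,
    fun q hq => if_pos hq⟩
  · split_ifs
    · exact div_nonneg (x.nonneg q) (mass_nonneg x)
    · exact le_rfl
  · split_ifs with hqB
    · rw [hxt.2.1 q fun hqt => hq (Finset.mem_inter.2 ⟨hqt, hqB⟩), zero_div]
    · rfl

/-- Let `m` be the mass on `B`. The point at height `r m` over the normalization `x / m` has second
coordinate `r m (1 - r m) x / m = r (1 - r m) x` on `B`. The division cancels, so the formula stays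
continuous at `m = 0`, where the normalization is undefined. -/
theorem exists_suspensionCoord (x : Realization X) (r : I) :
    ∃ y, suspensionCoord A y =
      (r * mass B x.1, fun q => if q ∈ B then r * (1 - r * mass B x.1) * x.1 q else 0) := by
  by_cases hx : mass B x.1 = 0
  · refine ⟨Suspension.south _, ?_⟩
    rw [hx]
    refine Prod.ext (by simp; rfl) (funext fun q => ?_)
    have hx' (q : P) (hq : q ∈ B) : x.1 q = 0 :=
      (Finset.sum_eq_zero_iff_of_nonneg fun q _ => x.nonneg q).1 hx q hq
    dsimp only
    split_ifs with hq
    · rw [hx' q hq, mul_zero]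
      rfl
    · rfl
  · obtain ⟨z, hz⟩ := h.exists_normalize x hx
    refine ⟨Suspension.mk _ (z, r * ⟨mass B x.1, mass_nonneg x, h.mass_le_one x⟩), ?_⟩
    rw [suspensionCoord_mk]
    refine Prod.ext rfl (funext fun q => ?_)
    dsimp only
    split_ifs with hq
    · rw [hz q hq]
      push_cast
      field_simp
    · rw [h.eq_zero_of_mem z hq, mul_zero]

/-- The projection of `X` to the suspension of `A`, with the height scaled by a factor. -/
noncomputable def toSuspension : C(Realization X × I, Suspension (Realization A)) :=
  ⟨fun z => (h.exists_suspensionCoord z.1 z.2).choose, by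
    rw [(isInducing_suspensionCoord h.finite).continuous_iff]
    have hz : (suspensionCoord A ∘ fun z : Realization X × I =>
        (h.exists_suspensionCoord z.1 z.2).choose) = fun z => (z.2 * mass B z.1.1,
          fun q => if q ∈ B then z.2 * (1 - z.2 * mass B z.1.1) * z.1.1 q else 0) :=
      funext fun z => (h.exists_suspensionCoord z.1 z.2).choose_spec
    rw [hz]
    have h1 : Continuous fun z : Realization X × I => z.1.1 :=
      continuous_subtype_val.comp continuous_fst
    refine Continuous.prodMk (by fun_prop) (continuous_pi fun q => ?_)
    have h2 := (continuous_apply q).comp h1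
    simp only [Function.comp_def] at h2
    split_ifs <;> fun_prop⟩

theorem toSuspension_eq_iff (x : Realization X) (r : I) (y : Suspension (Realization A)) :
    h.toSuspension (x, r) = y ↔ (((r : ℝ) * mass B x.1, fun q =>
      if q ∈ B then (r : ℝ) * (1 - r * mass B x.1) * x.1 q else 0) : ℝ × (P → ℝ)) =
        suspensionCoord A y := by
  rw [← suspensionCoord_injective.eq_iff]
  exact Eq.congr_left (h.exists_suspensionCoord x r).choose_spec

theorem toSuspension_south {x : Realization X} {r : I} (hx : (r : ℝ) * mass B x.1 = 0) :
    h.toSuspension (x, r) = Suspension.south _ := by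
  rw [toSuspension_eq_iff]
  refine Prod.ext hx (funext fun q => ?_)
  dsimp only
  split_ifs with hq
  · rcases mul_eq_zero.1 hx with h0 | h0
    · rw [h0, zero_mul, zero_mul]
      rfl
    · rw [(Finset.sum_eq_zero_iff_of_nonneg fun q _ => x.nonneg q).1 h0 q hq, mul_zero]
      rfl
  · rfl

theorem toSuspension_north (x : Realization A) :
    h.toSuspension (realizationIncl h.le x, 1) = Suspension.north _ := by
  rw [toSuspension_eq_iff]
  have : mass B (realizationIncl h.le x).1 = 1 := h.mass_of_mem x
  rw [this]
  refine Prod.ext (by simp; rfl) (funext fun q => ?_)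
  have h0 : ((1 : I) : ℝ) * (1 - ((1 : I) : ℝ) * 1) = 0 := by simp
  rw [h0]
  dsimp only
  split_ifs
  exacts [zero_mul _, rfl]

/-! ### The cone over `A` inside `X`. -/

/-- The point at height `t` on the segment from the apex to a point of `A`. -/
noncomputable def conePoint : C(Realization A × I, Realization X) :=
  ⟨fun z => ⟨fun q => (1 - (z.2 : ℝ)) * (Realization.vertex p h.apex_mem).1 q + z.2 * z.1.1 q, by
    obtain ⟨t, ht, hx⟩ := z.1.exists_isPoint
    exact ⟨insert p t, h.cone_le (Or.inr (Or.inr ⟨t, ht, rfl⟩)),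
      (IsPoint.convex (Realization.isPoint_vertex h.apex_mem (Finset.mem_insert_self p t))
        (hx.mono (Finset.subset_insert p t)) z.2)⟩⟩, by
    refine Realization.continuous_mk _ (continuous_pi fun q => ?_) _
    have := (Realization.continuous_apply q).comp
      (continuous_fst : Continuous (Prod.fst : Realization A × I → _))
    simp only [Function.comp_def] at this
    fun_prop⟩

theorem conePoint_apply (x : Realization A) (t : I) (q : P) : (h.conePoint (x, t)).1 q =
    if q = p then 1 - (t : ℝ) else if q ∈ B then t * x.1 q else 0 := by
  change (1 - (t : ℝ)) * (if q = p then 1 else 0) + t * x.1 q = _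
  split_ifs with hqp hqB
  · rw [hqp, h.apex_of_mem]
    ring
  · ring
  · rw [h.eq_zero_of_mem x hqB]
    ring

theorem mass_conePoint (x : Realization A) (t : I) : mass B (h.conePoint (x, t)).1 = t := by
  have : mass B (h.conePoint (x, t)).1 = t * mass B x.1 := by
    rw [mass, mass, Finset.mul_sum]
    refine Finset.sum_congr rfl fun q hq => ?_
    rw [h.conePoint_apply, if_neg (h.ne_apex hq), if_pos hq]
  rw [this, h.mass_of_mem, mul_one]

theorem outer_conePoint (x : Realization A) (t : I) : outer p B (h.conePoint (x, t)).1 = 0 := by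
  rw [outer, h.mass_conePoint, h.conePoint_apply, if_pos rfl]
  ring

theorem conePoint_zero (x : Realization A) :
    h.conePoint (x, 0) = Realization.vertex p h.apex_mem :=
  Subtype.ext (funext fun q => by
    change (1 - (0 : ℝ)) * _ + (0 : ℝ) * _ = _
    ring)

theorem conePoint_one (x : Realization A) : h.conePoint (x, 1) = realizationIncl h.le x :=
  Subtype.ext (funext fun q => by
    change (1 - (1 : ℝ)) * _ + (1 : ℝ) * x.1 q = x.1 q
    ring)

theorem toSuspension_conePoint (x : Realization A) (t : I) :
    h.toSuspension (h.conePoint (x, t), 1) = Suspension.mk _ (x, t) := by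
  rw [toSuspension_eq_iff, suspensionCoord_mk, mass_conePoint]
  refine Prod.ext (by simp) (funext fun q => ?_)
  dsimp only
  split_ifs with hq
  · rw [conePoint_apply, if_neg (h.ne_apex hq), if_pos hq]
    simp only [Set.Icc.coe_one]
    ring
  · rw [h.eq_zero_of_mem x hq, mul_zero]

end IsConePair

namespace IsConePair

variable {P : Type u} [DecidableEq P] {A X : PreAbstractSimplicialComplex P} {p : P} {B : Finset P}

/-! #### The quotient by the base of a cone -/

variable (h : IsConePair A X p B)
include h

/-- The map `push` on points of the realization, with variable parameters. -/
noncomputable def pushMap {Z : Type u} [TopologicalSpace Z] (x : C(Z, Realization X)) (r l : C(Z, I))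
    (hl : ∀ z, l z ≠ 0 → r z = 1 ∧ outer p B (x z).1 ≤ 1 / 2) : C(Z, Realization X) :=
  ⟨fun z => ⟨push p B (r z) (l z) (x z).1, h.push_isPoint (x z) (r z).2.1 (r z).2.2 (l z).2.1
      (l z).2.2 fun h0 => (hl z fun h0' => h0 (by rw [h0']; rfl)).imp (fun h1 => by rw [h1]; rfl) id⟩,
    Realization.continuous_mk _ (by
      have : Continuous fun z => (x z).1 := continuous_subtype_val.comp x.continuous
      fun_prop) _⟩

/-- The map `ΣA → X / A` induced by the cone over `A`. -/
noncomputable def fromSuspension : C(Suspension (Realization A),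
    Collapse (Realization X) (Set.range (realizationIncl h.le))) :=
  Suspension.lift ((Collapse.proj _).comp h.conePoint)
    (Collapse.proj _ (Realization.vertex p h.apex_mem)) (Collapse.base _)
    (fun x => congrArg (Collapse.proj (Set.range (realizationIncl h.le))) (h.conePoint_zero x))
    (fun x => (congrArg (Collapse.proj (Set.range (realizationIncl h.le)))
      (h.conePoint_one x)).trans (Collapse.proj_eq ⟨x, rfl⟩))

/-- If `z` is the normalization of `x` on `B`, then `y` is the point at height `r · mass B x` on the
segment from the apex to `z`, which is where both maps lead. If that height is `0`, then `y` is the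
apex. -/
theorem fromSuspension_toSuspension (x y : Realization X) (r : I)
    (hB : ∀ q ∈ B, y.1 q = r * x.1 q) (hp : y.1 p = 1 - r * mass B x.1)
    (ho : ∀ q, q ≠ p → q ∉ B → y.1 q = 0) :
    h.fromSuspension (h.toSuspension (x, r)) =
      Collapse.proj (Set.range (realizationIncl h.le)) y := by
  by_cases h0 : (r : ℝ) * mass B x.1 = 0
  · rw [h.toSuspension_south h0]
    refine congrArg (Collapse.proj (Set.range (realizationIncl h.le)))
      (Subtype.ext (funext fun q => ?_))
    change (if q = p then (1 : ℝ) else 0) = _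
    split_ifs with hq
    · rw [hq, hp, h0, sub_zero]
    · by_cases hqB : q ∈ B
      · rw [hB q hqB]
        rcases mul_eq_zero.1 h0 with h0 | h0
        · rw [h0, zero_mul]
        · rw [(Finset.sum_eq_zero_iff_of_nonneg fun q _ => x.nonneg q).1 h0 q hqB, mul_zero]
      · rw [ho q hq hqB]
  · have hm := right_ne_zero_of_mul h0
    obtain ⟨z, hz⟩ := h.exists_normalize x hm
    let m : I := ⟨mass B x.1, mass_nonneg x, h.mass_le_one x⟩
    have hs : h.toSuspension (x, r) = Suspension.mk _ (z, r * m) := by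
      rw [toSuspension_eq_iff, suspensionCoord_mk]
      refine Prod.ext rfl (funext fun q => ?_)
      dsimp only
      split_ifs with hq
      · rw [hz q hq]
        change _ = (r * mass B x.1) * (1 - r * mass B x.1) * _
        field_simp
      · rw [h.eq_zero_of_mem z hq, mul_zero]
    rw [hs]
    refine congrArg (Collapse.proj (Set.range (realizationIncl h.le)))
      (Subtype.ext (funext fun q => ?_))
    rw [h.conePoint_apply]
    split_ifs with hq hqB
    · rw [hq, hp]
      rfl
    · rw [hB q hqB, hz q hqB]
      change (r * mass B x.1) * _ = _
      field_simp
    · rw [ho q hq hqB]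

/-- The deformation of `X` into the cone, on a neighbourhood of it. -/
noncomputable def retract : C(Realization X, Realization X) :=
  h.pushMap (.id _) (.const _ 1) (.const _ 0) fun _ h0 => absurd rfl h0

theorem retract_val (x : Realization X) : (h.retract x).1 = push p B 1 0 x.1 := rfl

omit h in
theorem outer_le_of_clamp {a : ℝ} (ha : clamp (2 - 4 * a) ≠ 0) : a ≤ 1 / 2 := by
  by_contra hu
  exact ha (clamp_of_nonpos (by linarith))

omit h [DecidableEq P] in
theorem continuous_outer_val : Continuous fun x : Realization X => outer p B x.1 :=
  continuous_outer.comp continuous_subtype_val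

/-- The map of `X` homotopic to the identity that sends a neighbourhood of the cone to the apex. -/
noncomputable def crush : C(Realization X, Realization X) :=
  -- The contraction parameter is `1` for `u ≤ 1/4` and `0` for `u ≥ 1/2`, so it is non-zero only
  -- where the point has been pushed into the cone.
  h.pushMap (.id _) (.const _ 1) ⟨fun x => clamp (2 - 4 * outer p B x.1), by
      have := continuous_outer_val (X := X) (p := p) (B := B)
      fun_prop⟩
    fun _ h0 => ⟨rfl, outer_le_of_clamp h0⟩

theorem crush_val (x : Realization X) :
    (h.crush x).1 = push p B 1 (clamp (2 - 4 * outer p B x.1)) x.1 := rfl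

theorem crush_eq_vertex {x : Realization X} (hx : outer p B x.1 ≤ 1 / 4) :
    h.crush x = Realization.vertex p h.apex_mem := by
  refine Subtype.ext ?_
  rw [crush_val, clamp_of_one_le (by linarith), ← h.push_one_one x (by linarith)]
  rfl

/-- A homotopy from a map that pinches off the suspension of `A` to the map that crushes the cone. -/
noncomputable def pinchHomotopy : C(I × Realization X,
    Wedge (Realization X) (Suspension (Realization A)) (Realization.vertex p h.apex_mem)
      (Suspension.south _)) :=
  -- On `u = 1/4` the height factor vanishes and `crush` gives the apex, so the branches meet at the
  -- wedge point. At time `1` the whole part `u ≤ 1/4` is sent there.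
  ⟨fun z => if outer p B z.2.1 ≤ 1 / 4 then
      Wedge.inr _ _ (h.toSuspension (h.retract z.2, σ z.1 * clamp (1 - 4 * outer p B z.2.1)))
    else Wedge.inl _ _ (h.crush z.2), by
    have h1 : Continuous fun z : I × Realization X => outer p B z.2.1 :=
      continuous_outer_val (X := X) (p := p) (B := B).comp continuous_snd
    refine Continuous.if_le (by fun_prop) (by fun_prop) h1 continuous_const ?_
    intro z hz
    rw [h.crush_eq_vertex hz.le, hz, h.toSuspension_south, Wedge.glue]
    rw [clamp_of_nonpos (by norm_num), mul_zero]
    exact zero_mul _⟩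

theorem pinchHomotopy_apply (t : I) (x : Realization X) : h.pinchHomotopy (t, x) =
    if outer p B x.1 ≤ 1 / 4 then
      Wedge.inr _ _ (h.toSuspension (h.retract x, σ t * clamp (1 - 4 * outer p B x.1)))
    else Wedge.inl _ _ (h.crush x) := rfl

/-- The map `X / A → X ∨ ΣA` that pinches off the suspension of `A`. -/
noncomputable def pinch : C(Collapse (Realization X) (Set.range (realizationIncl h.le)),
    Wedge (Realization X) (Suspension (Realization A)) (Realization.vertex p h.apex_mem)
      (Suspension.south _)) :=
  Collapse.lift ⟨fun x => h.pinchHomotopy (0, x), by fun_prop⟩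
    (Wedge.inr _ _ (Suspension.north _)) (by
      rintro _ ⟨x, rfl⟩
      have hx : outer p B (realizationIncl h.le x).1 = 0 := h.outer_of_mem x
      have hr : h.retract (realizationIncl h.le x) = realizationIncl h.le x :=
        Subtype.ext (h.push_eq_self hx 1)
      rw [ContinuousMap.coe_mk, pinchHomotopy_apply, hx, if_pos (by norm_num), hr,
        ← h.toSuspension_north x, clamp_of_one_le (by norm_num), unitInterval.symm_zero, mul_one])

theorem pinch_proj (x : Realization X) :
    h.pinch (Collapse.proj _ x) = h.pinchHomotopy (0, x) := rfl

/-- On the cone `u = 0`, so `retract` is the identity and the height factor is `1`. There `pinch` is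
the projection to the suspension, which is inverse to the parametrization by cone points. -/
theorem pinch_fromSuspension (y : Suspension (Realization A)) :
    h.pinch (h.fromSuspension y) = Wedge.inr _ _ y := by
  have key (x : Realization X) (hx : outer p B x.1 = 0) :
      h.pinch (Collapse.proj _ x) = Wedge.inr _ _ (h.toSuspension (x, 1)) := by
    have hr : h.retract x = x := Subtype.ext (h.push_eq_self hx 1)
    rw [pinch_proj, pinchHomotopy_apply, hx, if_pos (by norm_num), hr,
      clamp_of_one_le (by norm_num), unitInterval.symm_zero, mul_one]
  induction y using Suspension.ind with
  | h x t =>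
    refine (key _ (h.outer_conePoint x t)).trans ?_
    rw [h.toSuspension_conePoint]
  | hs =>
    refine (key _ h.outer_apex).trans ?_
    rw [h.toSuspension_south]
    rw [h.mass_apex, mul_zero]
  | hn => rfl

/-- Lowering the suspension part to the south pole leads to `crush`, and undoing the deformation
then leads to the inclusion. The apex is fixed throughout. -/
theorem pinch_homotopicRel : (h.pinch.comp (Collapse.proj _)).HomotopicRel (Wedge.inl _ _)
    {Realization.vertex p h.apex_mem} := by
  have hc : Continuous fun z : I × Realization X => outer p B z.2.1 :=
    continuous_outer_val (X := X) (p := p) (B := B).comp continuous_snd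
  have hv : h.crush (Realization.vertex p h.apex_mem) = Realization.vertex p h.apex_mem :=
    h.crush_eq_vertex (by rw [h.outer_apex]; norm_num)
  have h1 (t : I) : h.pinchHomotopy (t, Realization.vertex p h.apex_mem) =
      Wedge.inl _ _ (Realization.vertex p h.apex_mem) := by
    have hr : h.retract (Realization.vertex p h.apex_mem) = Realization.vertex p h.apex_mem :=
      Subtype.ext (h.push_eq_self h.outer_apex 1)
    rw [pinchHomotopy_apply, h.outer_apex, if_pos (by norm_num), hr, h.toSuspension_south,
      Wedge.glue]
    rw [h.mass_apex, mul_zero]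
  -- For `t ≤ 1/2` the pushing parameter stays `1` while the contraction is undone; for `t ≥ 1/2`
  -- there is no contraction and the pushing is undone. This order is forced by the condition in
  -- `push_isPoint`.
  let G : C(I × Realization X, Realization X) := h.pushMap .snd
    ⟨fun z => clamp (2 - 2 * z.1), by fun_prop⟩
    ⟨fun z => clamp (1 - 2 * z.1) * clamp (2 - 4 * outer p B z.2.1), by fun_prop⟩
    fun z hz => by
      have hz1 := left_ne_zero_of_mul hz
      refine ⟨clamp_of_one_le ?_, outer_le_of_clamp (right_ne_zero_of_mul hz)⟩
      by_contra hz2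
      exact hz1 (clamp_of_nonpos (by linarith))
  have hG (t : I) (x : Realization X) : (G (t, x)).1 = push p B (clamp (2 - 2 * t))
      ((clamp (1 - 2 * t) * clamp (2 - 4 * outer p B x.1) : I) : ℝ) x.1 := rfl
  refine ContinuousMap.HomotopicRel.trans (g := (Wedge.inl _ _).comp h.crush) ⟨{
    toContinuousMap := h.pinchHomotopy
    map_zero_left := fun x => rfl
    map_one_left := fun x => ?_
    prop' := ?_ }⟩ ⟨{
    toContinuousMap := (Wedge.inl _ _).comp G
    map_zero_left := fun x => ?_
    map_one_left := fun x => ?_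
    prop' := ?_ }⟩
  · refine (h.pinchHomotopy_apply 1 x).trans ?_
    split_ifs with hx
    · rw [ContinuousMap.comp_apply, h.crush_eq_vertex hx, unitInterval.symm_one, zero_mul,
        h.toSuspension_south (zero_mul _), Wedge.glue]
    · rfl
  · rintro t _ rfl
    exact (h1 t).trans (h1 0).symm
  · refine congrArg (Wedge.inl _ _) (Subtype.ext ?_)
    rw [hG, crush_val, Set.Icc.coe_zero, clamp_of_one_le (t := 2 - 2 * 0) (by norm_num),
      clamp_of_one_le (t := 1 - 2 * 0) (by norm_num), one_mul]
    rfl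
  · refine congrArg (Wedge.inl _ _) (Subtype.ext ?_)
    rw [hG, Set.Icc.coe_one, clamp_of_nonpos (t := 2 - 2 * 1) (by norm_num),
      clamp_of_nonpos (t := 1 - 2 * 1) (by norm_num), zero_mul]
    exact push_zero_zero x
  · rintro t _ rfl
    refine congrArg (Wedge.inl _ _) (Eq.trans (Subtype.ext ?_) hv.symm)
    rw [hG, h.push_apex]

/-- If `X` contains the cone over a full subcomplex `A`, then `X / A ≃ X ∨ ΣA`. -/
theorem collapse_equiv : Nonempty (Collapse (Realization X) (Set.range (realizationIncl h.le)) ≃ₕ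
    Wedge (Realization X) (Suspension (Realization A)) (Realization.vertex p h.apex_mem)
      (Suspension.south _)) := by
  have hc : Continuous fun z : I × Realization X => outer p B z.2.1 :=
    continuous_outer_val (X := X) (p := p) (B := B).comp continuous_snd
  -- The initial contraction parameter is `min (4u) (2 - 4u)`, clamped to the unit interval: it
  -- rises from `0` on the cone to `1` at `u = 1/4` and is that of `crush` beyond. The bound `4u`
  -- keeps `A` fixed at all times.
  let G : C(I × Realization X, Realization X) := h.pushMap .snd
    ⟨fun z => clamp (2 - 2 * z.1), by fun_prop⟩
    ⟨fun z => clamp (min (4 * outer p B z.2.1)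
      (clamp (1 - 2 * z.1) * clamp (2 - 4 * outer p B z.2.1) : I)), by fun_prop⟩
    fun z hz => by
      have hz' : (clamp (1 - 2 * z.1) * clamp (2 - 4 * outer p B z.2.1) : I) ≠ 0 := fun h0 =>
        hz (clamp_of_nonpos (min_le_of_right_le (by rw [h0]; exact le_rfl)))
      refine ⟨clamp_of_one_le ?_, outer_le_of_clamp (right_ne_zero_of_mul hz')⟩
      by_contra hz2
      exact left_ne_zero_of_mul hz' (clamp_of_nonpos (by linarith))
  have hG (t : I) (x : Realization X) : (G (t, x)).1 = push p B (clamp (2 - 2 * t))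
      (clamp (min (4 * outer p B x.1)
        (clamp (1 - 2 * t) * clamp (2 - 4 * outer p B x.1) : I))) x.1 := rfl
  have hG0 (x : Realization X) : (G (0, x)).1 = push p B 1
      (clamp (min (4 * outer p B x.1) (clamp (2 - 4 * outer p B x.1)))) x.1 := by
    rw [hG, Set.Icc.coe_zero, clamp_of_one_le (t := 2 - 2 * 0) (by norm_num),
      clamp_of_one_le (t := 1 - 2 * 0) (by norm_num), one_mul]
    rfl
  refine collapse_equiv_wedge h.fromSuspension rfl h.pinch h.pinch_fromSuspension
    h.pinch_homotopicRel G ?_ ?_ ?_ rfl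
  · rintro t _ ⟨x, rfl⟩
    refine ⟨x, (Subtype.ext ?_ : G _ = _).symm⟩
    have hx : outer p B (realizationIncl h.le x).1 = 0 := h.outer_of_mem x
    rw [hG, hx, clamp_of_nonpos (min_le_of_left_le (by norm_num))]
    exact h.push_eq_self hx _
  · refine fun x => Subtype.ext ?_
    rw [hG, Set.Icc.coe_one, clamp_of_nonpos (t := 2 - 2 * 1) (by norm_num),
      clamp_of_nonpos (t := 1 - 2 * 1) (by norm_num), zero_mul,
      Set.Icc.coe_zero, clamp_of_nonpos (min_le_of_right_le le_rfl)]
    exact push_zero_zero x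
  · intro x
    rw [pinch_proj, pinchHomotopy_apply]
    have hu0 := h.outer_nonneg x
    have hr (hu : outer p B x.1 ≤ 1 / 4) :
        ((σ 0 * clamp (1 - 4 * outer p B x.1) : I) : ℝ) = 1 - 4 * outer p B x.1 := by
      rw [unitInterval.symm_zero, one_mul, coe_clamp, min_eq_right (by linarith),
        max_eq_right (by linarith)]
    -- For `u ≤ 1/4` the round trip through `ΣA` multiplies the `B`-coordinates of the retracted
    -- point by `1 - 4u` and gives the lost mass to `p`, which is `push` with `l = 4u`. For `u >
    -- 1/4` both sides are `crush`.
    split_ifs with hu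
    · refine h.fromSuspension_toSuspension _ _ _ ?_ ?_ ?_
      all_goals
        rw [hG0, clamp_of_one_le (t := 2 - 4 * _) (by linarith),
          clamp_eq (s := ⟨4 * outer p B x.1, by linarith, by linarith⟩)
            (min_eq_left (by simp; linarith))]
      · intro q hq
        rw [hr hu, retract_val, push, push, if_neg (h.ne_apex hq), if_neg (h.ne_apex hq), if_pos hq,
          if_pos hq]
        ring
      · rw [hr hu, retract_val, h.mass_push, push, if_pos rfl]
        have h1 := scale_add (r := 1) (u := outer p B x.1)
        rw [outerScale_one (by linarith), zero_mul, add_zero] at h1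
        have h2 : x.1 p = 1 - outer p B x.1 - mass B x.1 := by rw [outer]; ring
        rw [h2]
        linear_combination h1
      · intro q hq hqB
        rw [push, if_neg hq, if_neg hqB, outerScale_one (by linarith), zero_mul]
    · refine congrArg (Collapse.proj (Set.range (realizationIncl h.le))) (Subtype.ext ?_)
      rw [hG0, crush_val, min_eq_right, clamp_coe]
      exact (clamp (2 - 4 * outer p B x.1)).2.2.trans (by linarith)

/-- The equivalence `X / A ≃ X ∨ ΣA` at any base point in the path component of the apex. -/
theorem collapse_equiv_suspension {y₀ : Realization X}
    (hy : Joined (Realization.vertex p h.apex_mem) y₀) :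
    Nonempty (Collapse (Realization X) (Set.range (realizationIncl h.le)) ≃ₕ
      Wedge (Realization X) (Suspension (Realization A)) y₀ (Suspension.south _)) := by
  obtain ⟨e⟩ := h.collapse_equiv
  obtain ⟨e'⟩ := wedge_suspension_equiv_of_joined (A := Realization A) hy
  exact ⟨e.trans e'⟩

/-- The equivalence `X / A ≃ X ∨ ΣA` with the reduced suspension. -/
theorem collapse_equiv_reducedSuspension {y₀ : Realization X}
    (hy : Joined (Realization.vertex p h.apex_mem) y₀) (x₀ : Realization A) :
    Nonempty (Collapse (Realization X) (Set.range (realizationIncl h.le)) ≃ₕ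
      Wedge (Realization X) (ReducedSuspension (Realization A) x₀) y₀
        (ReducedSuspension.base x₀)) := by
  obtain ⟨e⟩ := h.collapse_equiv_suspension hy
  obtain ⟨w, c, hw, hc₀, hcx, hc₁⟩ := Realization.exists_contraction x₀
  obtain ⟨f, g, hf, hg, hgf, hfg⟩ := suspension_equiv_reduced w c hw hc₀ hcx hc₁
  obtain ⟨e'⟩ := wedge_equiv_of_pointed y₀ f g hf hg hgf hfg
  exact ⟨e.trans e'⟩

end IsConePair

/-! ### Morse matchings on a cone -/

section Combinatorics

variable {V : Type u} [DecidableEq V]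

omit [DecidableEq V] in
theorem notMem_of_mem_faces {K : PreAbstractSimplicialComplex V} {v : V} (hv : {v} ∉ K.faces)
    {s : Finset V} (hs : s ∈ K.faces) : v ∉ s := fun h =>
  hv ((K.isRelLowerSet_faces hs).2 (Finset.singleton_subset_iff.2 h) (Finset.singleton_nonempty v))

/-- A matching of `K` remains acyclic if the apex of a cone is matched with an edge to `K`. -/
theorem insert_mem_matchingComplex_cone {K : PreAbstractSimplicialComplex V} {v w : V}
    (hv : {v} ∉ K.faces) (hw : {w} ∈ K.faces) {W : Finset (Finset V × Finset V)}
    (hW : W = ∅ ∨ W ∈ (matchingComplex K).faces) :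
    insert (({v} : Finset V), ({v, w} : Finset V)) W ∈ (matchingComplex (cone v K)).faces := by
  have hvw : v ≠ w := fun h => hv (h ▸ hw)
  have hWK (q) (hq : q ∈ W) : q.1 ∈ K.faces ∧ q.2 ∈ K.faces ∧ q.1 ⊆ q.2 ∧
      q.2.card = q.1.card + 1 := by
    rcases hW with rfl | hW
    · exact absurd hq (Finset.notMem_empty q)
    · exact ⟨hW.fst_mem q hq, hW.snd_mem q hq, hW.subset q hq, hW.card_eq q hq⟩
  have hWv (q) (hq : q ∈ W) : v ∉ q.1 ∧ v ∉ q.2 :=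
    ⟨notMem_of_mem_faces hv (hWK q hq).1, notMem_of_mem_faces hv (hWK q hq).2.1⟩
  have hWd (q) (hq : q ∈ W) (r) (hr : r ∈ W) (hqr : q ≠ r) :
      q.1 ≠ r.1 ∧ q.1 ≠ r.2 ∧ q.2 ≠ r.1 ∧ q.2 ≠ r.2 := by
    rcases hW with rfl | hW
    · exact absurd hq (Finset.notMem_empty q)
    · exact hW.disjoint q hq r hr hqr
  have hWa (α) : ¬ Relation.TransGen (GradientStep W) α α := by
    rcases hW with rfl | hW
    · intro h
      obtain ⟨b, ⟨β, hβ, -⟩, -⟩ := Relation.TransGen.head'_iff.1 h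
      exact Finset.notMem_empty _ hβ
    · exact hW.acyclic α
  have hne (s t : Finset V) (hs : v ∈ s) (ht : v ∉ t) : s ≠ t := fun h => ht (h ▸ hs)
  -- For the new pair, a one-vertex set containing `v` would be `{v}` itself, which a step excludes.
  -- All other steps end in a face of a simplex of `K`.
  have htgt {α α' : Finset V} (h : GradientStep (insert (({v} : Finset V), ({v, w} : Finset V)) W)
      α α') : v ∉ α' := by
    obtain ⟨β, hβ, hsub, hcard, hneq⟩ := h
    rcases Finset.mem_insert.1 hβ with h | h
    · rw [Prod.mk.injEq] at h
      obtain ⟨rfl, rfl⟩ := h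
      intro hv'
      refine hneq (Finset.eq_of_subset_of_card_le (Finset.singleton_subset_iff.2 hv') ?_).symm
      rw [hcard]
    · exact fun hv' => (hWv _ h).2 (hsub hv')
  have hstep {α α' : Finset V} (hα : v ∉ α)
      (h : GradientStep (insert (({v} : Finset V), ({v, w} : Finset V)) W) α α') :
      GradientStep W α α' := by
    obtain ⟨β, hβ, h⟩ := h
    refine ⟨β, (Finset.mem_insert.1 hβ).resolve_left fun h' => hα ?_, h⟩
    rw [(Prod.mk.inj h').1]
    exact Finset.mem_singleton_self v
  refine ⟨⟨⟨_, Finset.mem_insert_self _ _⟩, ?_, ?_, ?_, ?_, ?_⟩, ?_⟩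
  · intro q hq
    rcases Finset.mem_insert.1 hq with rfl | hq
    · exact Or.inr (Or.inl rfl)
    · exact Or.inl (hWK q hq).1
  · intro q hq
    rcases Finset.mem_insert.1 hq with rfl | hq
    · exact Or.inr (Or.inr ⟨{w}, hw, rfl⟩)
    · exact Or.inl (hWK q hq).2.1
  · intro q hq
    rcases Finset.mem_insert.1 hq with rfl | hq
    · simp
    · exact (hWK q hq).2.2.1
  · intro q hq
    rcases Finset.mem_insert.1 hq with rfl | hq
    · rw [Finset.card_pair hvw, Finset.card_singleton]
    · exact (hWK q hq).2.2.2
  · have h1 : v ∈ ({v} : Finset V) := by simp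
    have h2 : v ∈ ({v, w} : Finset V) := by simp
    intro q hq r hr hqr
    rcases Finset.mem_insert.1 hq with rfl | hq <;> rcases Finset.mem_insert.1 hr with rfl | hr
    · exact absurd rfl hqr
    · exact ⟨hne _ _ h1 (hWv r hr).1, hne _ _ h1 (hWv r hr).2, hne _ _ h2 (hWv r hr).1,
        hne _ _ h2 (hWv r hr).2⟩
    · exact ⟨(hne _ _ h1 (hWv q hq).1).symm, (hne _ _ h2 (hWv q hq).1).symm,
        (hne _ _ h1 (hWv q hq).2).symm, (hne _ _ h2 (hWv q hq).2).symm⟩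
    · exact hWd q hq r hr hqr
  -- On a closed path every simplex is the end of a step, so none contains `v`. All steps then use
  -- pairs of `W`, which is acyclic.
  · intro α hα
    obtain ⟨b, -, hb⟩ := Relation.TransGen.tail'_iff.1 hα
    have key {γ : Finset V} (h : Relation.TransGen
        (GradientStep (insert (({v} : Finset V), ({v, w} : Finset V)) W)) α γ) :
        Relation.TransGen (GradientStep W) α γ := by
      induction h with
      | single h => exact .single (hstep (htgt hb) h)
      | tail h h' ih =>
        obtain ⟨c, -, hc⟩ := Relation.TransGen.tail'_iff.1 h
        exact ih.tail (hstep (htgt hc) h')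
    exact hWa α (key hα)

/-- Two disjoint pairs form an acyclic matching. -/
theorem pair_mem_matchingComplex {L : PreAbstractSimplicialComplex V} {q r : Finset V × Finset V}
    (hq : {q} ∈ (matchingComplex L).faces) (hr : {r} ∈ (matchingComplex L).faces)
    (hqr : q.1 ≠ r.1 ∧ q.1 ≠ r.2 ∧ q.2 ≠ r.1 ∧ q.2 ≠ r.2) :
    {q, r} ∈ (matchingComplex L).faces := by
  have hd (a) (ha : a ∈ ({q, r} : Finset (Finset V × Finset V))) (b)
      (hb : b ∈ ({q, r} : Finset (Finset V × Finset V))) (hab : a ≠ b) :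
      a.1 ≠ b.1 ∧ a.1 ≠ b.2 ∧ a.2 ≠ b.1 ∧ a.2 ≠ b.2 := by
    rw [Finset.mem_insert, Finset.mem_singleton] at ha hb
    rcases ha with rfl | rfl <;> rcases hb with rfl | rfl
    · exact absurd rfl hab
    · exact hqr
    · exact ⟨hqr.1.symm, hqr.2.2.1.symm, hqr.2.1.symm, hqr.2.2.2.symm⟩
    · exact absurd rfl hab
  have hp {φ : Finset V × Finset V → Prop} (h1 : φ q) (h2 : φ r) (a)
      (ha : a ∈ ({q, r} : Finset (Finset V × Finset V))) : φ a := by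
    rw [Finset.mem_insert, Finset.mem_singleton] at ha
    rcases ha with rfl | rfl
    exacts [h1, h2]
  have hs (a) : a ∈ ({a} : Finset (Finset V × Finset V)) := Finset.mem_singleton_self a
  have hsub := hp (φ := fun a => a.1 ⊆ a.2) (hq.subset q (hs q)) (hr.subset r (hs r))
  have hcard := hp (φ := fun a => a.2.card = a.1.card + 1) (hq.card_eq q (hs q))
    (hr.card_eq r (hs r))
  refine ⟨⟨⟨q, by simp⟩, hp (hq.fst_mem q (hs q)) (hr.fst_mem r (hs r)),
    hp (hq.snd_mem q (hs q)) (hr.snd_mem r (hs r)), hsub, hcard, hd⟩, fun α hα => ?_⟩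
  have hsrc {a b : Finset V} (h : GradientStep {q, r} a b) : a = q.1 ∨ a = r.1 := by
    obtain ⟨β, hβ, -⟩ := h
    exact hp (φ := fun c => c.1 = q.1 ∨ c.1 = r.1) (Or.inl rfl) (Or.inr rfl) _ hβ
  -- Every simplex on a closed path is the first member of `q` or `r`. Consecutive ones differ, so
  -- the path alternates and returns to `α` after two steps.
  have hback : ∃ b, GradientStep {q, r} α b ∧ GradientStep {q, r} b α := by
    obtain ⟨b, hab, hb⟩ := Relation.TransGen.head'_iff.1 hα
    have hba : b ≠ α := hab.choose_spec.2.2.2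
    rcases hb.cases_head with rfl | ⟨c, hbc, hc⟩
    · exact absurd rfl hba
    have hcb : c ≠ b := hbc.choose_spec.2.2.2
    have hcs : c = q.1 ∨ c = r.1 := by
      rcases hc.cases_head with rfl | ⟨d, hcd, -⟩
      exacts [hsrc hab, hsrc hcd]
    have : c = α := by
      rcases hcs with rfl | rfl <;> rcases hsrc hbc with rfl | rfl <;>
        rcases hsrc hab with rfl | rfl <;> first | rfl | exact absurd rfl hcb | exact absurd rfl hba
    exact ⟨b, hab, this ▸ hbc⟩
  obtain ⟨b, ⟨β, hβ, hbβ, hbc, hne⟩, ⟨β', hβ', hαβ', -, -⟩⟩ := hback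
  -- Two distinct simplices of equal dimension have a union with at least one more vertex. It
  -- therefore exhausts both `β` and `β'`, contrary to the disjointness of the pairs.
  have hlt : α.card + 1 ≤ (α ∪ b).card := by
    by_contra h
    have h1 : α = α ∪ b := Finset.eq_of_subset_of_card_le Finset.subset_union_left (by omega)
    refine hne (Finset.eq_of_subset_of_card_le ?_ hbc.ge)
    rw [h1]
    exact Finset.subset_union_right
  have h1 : α ∪ b = β := Finset.eq_of_subset_of_card_le (Finset.union_subset (hsub _ hβ) hbβ)
    (by rw [hcard _ hβ]; exact hlt)
  have h2 : α ∪ b = β' := Finset.eq_of_subset_of_card_le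
    (Finset.union_subset hαβ' (hsub _ hβ')) (by rw [hcard _ hβ', hbc]; exact hlt)
  exact (hd _ hβ _ hβ' fun h => hne (Prod.mk.inj h).1.symm).2.2.2 (h1.symm.trans h2)

/-- Fullness holds because being a gradient vector field refers to the complex only through
membership of the simplices in the pairs. -/
theorem isConePair_matchingComplex {K : PreAbstractSimplicialComplex V} (hK : K.faces.Finite)
    {v w : V} (hv : {v} ∉ K.faces) (hw : {w} ∈ K.faces) :
    IsConePair (matchingComplex K) (matchingComplex (cone v K))
      (({v} : Finset V), ({v, w} : Finset V)) (hK.toFinset ×ˢ hK.toFinset) where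
  finite := by
    refine (Finset.finite_toSet (hK.toFinset ×ˢ hK.toFinset).powerset).subset fun W hW => ?_
    rw [Finset.mem_coe, Finset.mem_powerset]
    intro q hq
    simp [hW.fst_mem q hq, hW.snd_mem q hq]
  cone_le := by
    rintro W (hW | rfl | ⟨W, hW, rfl⟩)
    · exact matchingComplex_mono (le_cone v K) hW
    · exact insert_mem_matchingComplex_cone hv hw (Or.inl rfl)
    · exact insert_mem_matchingComplex_cone hv hw (Or.inr hW)
  subset W hW q hq := by
    simp [hW.fst_mem q hq, hW.snd_mem q hq]
  full W hW hWB := by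
    have h (q) (hq : q ∈ W) : q.1 ∈ K.faces ∧ q.2 ∈ K.faces := by
      simpa using hWB hq
    exact ⟨⟨hW.nonempty, fun q hq => (h q hq).1, fun q hq => (h q hq).2, hW.subset, hW.card_eq,
      hW.disjoint⟩, hW.acyclic⟩
  notMem := by
    simp [hv]

/-- `M(CK)` contains a cone over `M(K)` with apex in the path component of any given point. -/
theorem exists_isConePair_joined {K : PreAbstractSimplicialComplex V} (hK : K.faces.Finite)
    {v : V} (hv : {v} ∉ K.faces) (y₀ : MorseSpace (cone v K)) :
    ∃ (p : Finset V × Finset V) (B : Finset (Finset V × Finset V))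
      (h : IsConePair (matchingComplex K) (matchingComplex (cone v K)) p B),
      Joined (Realization.vertex p h.apex_mem) y₀ := by
  obtain ⟨q, hq, hqy⟩ := Realization.joined_vertex y₀
  by_cases hM : (matchingComplex K).faces.Nonempty
  · obtain ⟨W, hW⟩ := hM
    obtain ⟨r, hrW⟩ := hW.nonempty
    have hr : {r} ∈ (matchingComplex K).faces := ((matchingComplex K).isRelLowerSet_faces hW).2
      (Finset.singleton_subset_iff.2 hrW) (Finset.singleton_nonempty r)
    have hr1 := (K.isRelLowerSet_faces (hW.fst_mem r hrW)).1
    have hrc := hW.card_eq r hrW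
    -- The vertex `w` is chosen outside `r.1`, so that `r.1` cannot be `{w}`. This excludes `q.2 =
    -- {v, w}` in the last case below.
    obtain ⟨w, hw⟩ : (r.2 \ r.1).Nonempty := by
      rw [← Finset.card_pos, Finset.card_sdiff_of_subset (hW.subset r hrW)]
      omega
    rw [Finset.mem_sdiff] at hw
    have hwK : {w} ∈ K.faces := (K.isRelLowerSet_faces (hW.snd_mem r hrW)).2
      (Finset.singleton_subset_iff.2 hw.1) (Finset.singleton_nonempty w)
    have h := isConePair_matchingComplex hK hv hwK
    refine ⟨_, _, h, (hqy.trans ?_).symm⟩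
    have hvw : v ≠ w := fun e => hv (e ▸ hwK)
    have hA {s} (hs : {s} ∈ (matchingComplex K).faces)
        (hs' : {s} ∈ (matchingComplex (cone v K)).faces) :
        Joined (Realization.vertex s hs') (Realization.vertex _ h.apex_mem) :=
      Realization.joined_vertex_vertex _ _ (by
        rw [Finset.pair_comm]
        exact h.cone_le (Or.inr (Or.inr ⟨_, hs, rfl⟩)))
    have hq1 : q.1 ∈ (cone v K).faces := hq.fst_mem q (Finset.mem_singleton_self q)
    have hq2 : q.2 ∈ (cone v K).faces := hq.snd_mem q (Finset.mem_singleton_self q)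
    have hqs := hq.subset q (Finset.mem_singleton_self q)
    have hqc := hq.card_eq q (Finset.mem_singleton_self q)
    by_cases hqK : q.2 ∈ K.faces
    · refine hA (h.full _ hq ?_) hq
      have hq1' := (K.isRelLowerSet_faces hqK).2 hqs ((cone v K).isRelLowerSet_faces hq1).1
      simp [hqK, hq1']
    have hvq : v ∈ q.2 := by
      rcases hq2 with h | h | ⟨t, -, h⟩
      · exact absurd h hqK
      · simp [h]
      · simp [h]
    have hvr1 := notMem_of_mem_faces hv (hW.fst_mem r hrW)
    have hvr2 := notMem_of_mem_faces hv (hW.snd_mem r hrW)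
    have hr' := h.le hr
    -- Here `v ∈ q.2`, so `q` can meet `r` only in `q.1`. If it does not, the path goes from `q`
    -- through `r` to the apex. If it does, then `v ∉ q.1`, and `q` is disjoint from the apex and
    -- directly joined to it.
    by_cases hd : q.1 ≠ r.1 ∧ q.1 ≠ r.2
    · refine (Realization.joined_vertex_vertex hq hr' (pair_mem_matchingComplex hq hr' ⟨hd.1, hd.2,
        fun e => hvr1 (e ▸ hvq), fun e => hvr2 (e ▸ hvq)⟩)).trans (hA hr hr')
    · have hd' : q.1 = r.1 ∨ q.1 = r.2 := by
        by_contra hd'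
        exact hd (not_or.1 hd')
      have hvq1 : v ∉ q.1 := by
        rcases hd' with e | e <;> rw [e] <;> assumption
      have hpos := Finset.card_pos.2 hr1
      refine Realization.joined_vertex_vertex hq h.apex_mem (pair_mem_matchingComplex hq h.apex_mem
        ⟨fun e => hvq1 ?_, fun e => hvq1 ?_, fun e => ?_, fun e => ?_⟩)
      · rw [e]; simp
      · rw [e]; simp
      · rw [e, Finset.card_singleton] at hqc
        rcases hd' with e | e <;> rw [e] at hqc <;> omega
      -- If `q.2 = {v, w}`, then `q.1` is a single vertex. It cannot be `r.2`, which has at least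
      -- two vertices, so it is `r.1`, a subset of `{v, w}` containing neither `v` nor `w`.
      · dsimp only at e
        rw [e, Finset.card_pair hvw] at hqc
        rcases hd' with e' | e'
        · obtain ⟨a, ha⟩ := hr1
          have ha' : a ∈ ({v, w} : Finset V) := e ▸ hqs (e' ▸ ha)
          rw [Finset.mem_insert, Finset.mem_singleton] at ha'
          rcases ha' with rfl | rfl
          exacts [hvr1 ha, hw.2 ha]
        · rw [e'] at hqc
          omega
  -- For empty `M(K)` the cone is just its apex, so any vertex joined to `y₀` will do, with `B = ∅`.
  · rw [Set.not_nonempty_iff_eq_empty] at hM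
    refine ⟨q, ∅, ⟨by rw [hM]; exact Set.finite_empty, ?_, ?_, ?_, Finset.notMem_empty q⟩, hqy.symm⟩
    · rintro W (hW | rfl | ⟨W, hW, rfl⟩)
      · rw [hM] at hW
        exact hW.elim
      · exact hq
      · rw [hM] at hW
        exact hW.elim
    · intro s hs
      rw [hM] at hs
      exact hs.elim
    · intro s hs hs'
      exact absurd (Finset.subset_empty.1 hs') hs.nonempty.ne_empty

/-! ### Vertices of a complex, and the simplex as a cone over a facet. -/

omit [DecidableEq V] in
theorem exists_vertex_mem {K : PreAbstractSimplicialComplex V} (hK : K.faces.Nonempty) :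
    ∃ w, {w} ∈ K.faces := by
  obtain ⟨s, hs⟩ := hK
  obtain ⟨w, hw⟩ := (K.isRelLowerSet_faces hs).1
  exact ⟨w, (K.isRelLowerSet_faces hs).2 (Finset.singleton_subset_iff.2 hw)
    (Finset.singleton_nonempty w)⟩

theorem fullSimplex_eq_cone {S : Finset V} {v : V} (hv : v ∈ S) :
    fullSimplex S = cone v (fullSimplex (S.erase v)) := by
  refine le_antisymm (fun s hs => ?_) (fun s hs => ?_)
  · by_cases hvs : v ∈ s
    · by_cases he : (s.erase v).Nonempty
      · exact Or.inr (Or.inr ⟨s.erase v, ⟨he, Finset.erase_subset_erase v hs.2⟩,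
          (Finset.insert_erase hvs).symm⟩)
      · rw [Finset.not_nonempty_iff_eq_empty] at he
        refine Or.inr (Or.inl ?_)
        rw [← Finset.insert_erase hvs, he]
        rfl
    · exact Or.inl ⟨hs.1, Finset.subset_erase.2 ⟨hs.2, hvs⟩⟩
  · rcases hs with hs | rfl | ⟨t, ht, rfl⟩
    · exact fullSimplex_erase_le S v hs
    · exact ⟨Finset.singleton_nonempty v, Finset.singleton_subset_iff.2 hv⟩
    · exact ⟨Finset.insert_nonempty v t, Finset.insert_subset hv
        (ht.2.trans (Finset.erase_subset v S))⟩

end Combinatorics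

/-! ### The inclusion `M(K) → M(CK)` -/

section Inclusion

variable {V : Type u} [DecidableEq V] {K L : PreAbstractSimplicialComplex V} {v : V}

/-- The inclusion `M(K) → M(CK)` factors through a contractible space. -/
theorem exists_factor (hK : K.faces.Nonempty) (hfin : K.faces.Finite) (hv : {v} ∉ K.faces)
    (hKL : K ≤ L) (hL : L = cone v K) :
    ∃ (p : Finset V × Finset V) (j : C(Realization (cone p (matchingComplex K)), MorseSpace L)),
      morseIncl hKL = j.comp (realizationIncl (le_cone p _)) := by
  -- Stating the cone through an equation for `L` lets the result serve both `CK` itself and `Δⁿ`,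
  -- which equals a cone only propositionally.
  subst hL
  obtain ⟨w, hw⟩ := exists_vertex_mem hK
  exact ⟨_, realizationIncl (isConePair_matchingComplex hfin hv hw).cone_le, rfl⟩

variable (hK : K.faces.Nonempty) (hfin : K.faces.Finite) (hv : {v} ∉ K.faces) (hKL : K ≤ L)
  (hL : L = cone v K)
include hK hfin hv hL

theorem morseIncl_nullhomotopic : (morseIncl hKL).Nullhomotopic := by
  obtain ⟨p, j, hj⟩ := exists_factor hK hfin hv hKL hL
  have := Realization.contractibleSpace_cone p (matchingComplex K)
  rw [hj]
  obtain ⟨z, hz⟩ := id_nullhomotopic (Realization (cone p (matchingComplex K)))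
  exact ⟨j z, (ContinuousMap.Homotopic.refl j).comp (hz.comp (.refl (realizationIncl (le_cone p _))))⟩

theorem reducedHomologyMap_morseIncl (G : AddCommGrpCat.{u}) (k : ℤ) :
    reducedHomologyMap G (morseIncl hKL) k = 0 := by
  obtain ⟨p, j, hj⟩ := exists_factor hK hfin hv hKL hL
  have := Realization.contractibleSpace_cone p (matchingComplex K)
  rw [hj]
  exact reducedHomologyMap_eq_zero_of_factor G _ j k

theorem morseIncl_segment (G : AddCommGrpCat.{u}) (k : ℤ) :
    (pairHomologySegment G (morseIncl hKL) (realizationIncl_injective _) k).ShortExact ∧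
      Nonempty (pairHomologySegment G (morseIncl hKL) (realizationIncl_injective _) k).Splitting := by
  obtain ⟨p, j, hj⟩ := exists_factor hK hfin hv hKL hL
  have := Realization.contractibleSpace_cone p (matchingComplex K)
  have hi : Function.Injective (morseIncl hKL) := realizationIncl_injective _
  change (pairHomologySegment G (morseIncl hKL) hi k).ShortExact ∧
    Nonempty (pairHomologySegment G (morseIncl hKL) hi k).Splitting
  -- The segment depends on a proof of injectivity of the map, so the map is made a variable before
  -- the factorization is substituted.
  generalize morseIncl hKL = i at hj hi
  subst hj
  exact ⟨pairHomologySegment_shortExact_of_factor G _ j hi k,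
    pairHomologySegment_splitting_of_factor G _ j hi k⟩

theorem relativeHomology_morseIncl (G : AddCommGrpCat.{u}) (k : ℤ) :
    Nonempty (relativeHomology G (morseIncl hKL) k ≃+
      reducedHomology G (MorseSpace L) k × reducedHomology G (MorseSpace K) (k - 1)) := by
  obtain ⟨-, ⟨s⟩⟩ := morseIncl_segment hK hfin hv hKL hL G k
  exact addEquiv_of_splitting s

end Inclusion

end MorseMatching

/-! ### The theorem, for cones and for simplices. -/

theorem mainTheorem8 {V : Type u} [DecidableEq V] :
    (∀ (K : PreAbstractSimplicialComplex V) (v : V), K.faces.Finite → K.faces.Nonempty →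
      {v} ∉ K.faces →
      -- the inclusion is zero on reduced homology
      (∀ (G : AddCommGrpCat.{u}) (k : ℤ),
        reducedHomologyMap G (morseIncl (le_cone v K)) k = 0) ∧
      -- the cofiber, with the unreduced suspension (`M(K)` may be empty)
      (∀ y₀ : MorseSpace (cone v K),
        Nonempty (Collapse (MorseSpace (cone v K)) (Set.range (morseIncl (le_cone v K))) ≃ₕ
          Wedge (MorseSpace (cone v K)) (Suspension (MorseSpace K)) y₀ (Suspension.south _))) ∧
      -- the cofiber, with the reduced suspension at any base point of `M(K)`
      (∀ (y₀ : MorseSpace (cone v K)) (x₀ : MorseSpace K),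
        Nonempty (Collapse (MorseSpace (cone v K)) (Set.range (morseIncl (le_cone v K))) ≃ₕ
          Wedge (MorseSpace (cone v K)) (ReducedSuspension (MorseSpace K) x₀)
            y₀ (ReducedSuspension.base x₀))) ∧
      -- the relative homology
      (∀ (G : AddCommGrpCat.{u}) (k : ℤ),
        Nonempty (relativeHomology G (morseIncl (le_cone v K)) k ≃+
          reducedHomology G (MorseSpace (cone v K)) k ×
            reducedHomology G (MorseSpace K) (k - 1))) ∧
      -- the long exact sequence splits into (split) short exact sequences
      (∀ (G : AddCommGrpCat.{u}) (k : ℤ),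
        (pairHomologySegment G (morseIncl (le_cone v K))
          (realizationIncl_injective _) k).ShortExact ∧
        Nonempty (pairHomologySegment G (morseIncl (le_cone v K))
          (realizationIncl_injective _) k).Splitting)) ∧
    -- the case of the simplex `Δⁿ` with vertex set `S` and its facet opposite to `v`
    (∀ (n : ℕ) (S : Finset V) (v : V), 2 ≤ n → S.card = n + 1 → v ∈ S →
      (morseIncl (fullSimplex_erase_le S v)).Nullhomotopic ∧
      (∀ (G : AddCommGrpCat.{u}) (k : ℤ),
        (pairHomologySegment G (morseIncl (fullSimplex_erase_le S v))
          (realizationIncl_injective _) k).ShortExact ∧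
        Nonempty (pairHomologySegment G (morseIncl (fullSimplex_erase_le S v))
          (realizationIncl_injective _) k).Splitting) ∧
      (∀ (G : AddCommGrpCat.{u}) (k : ℤ),
        Nonempty (relativeHomology G (morseIncl (fullSimplex_erase_le S v)) k ≃+
          reducedHomology G (MorseSpace (fullSimplex S)) k ×
            reducedHomology G (MorseSpace (fullSimplex (S.erase v))) (k - 1)))) := by
  refine ⟨fun K v hfin hK hv => ⟨fun G k => ?_, fun y₀ => ?_, fun y₀ x₀ => ?_, fun G k => ?_,
    fun G k => ?_⟩, fun n S v hn hS hvS => ?_⟩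
  · exact reducedHomologyMap_morseIncl hK hfin hv _ rfl G k
  · obtain ⟨p, B, h, hy⟩ := exists_isConePair_joined hfin hv y₀
    exact h.collapse_equiv_suspension hy
  · obtain ⟨p, B, h, hy⟩ := exists_isConePair_joined hfin hv y₀
    exact h.collapse_equiv_reducedSuspension hy x₀
  · exact relativeHomology_morseIncl hK hfin hv _ rfl G k
  · exact morseIncl_segment hK hfin hv _ rfl G k
  · have hK : (fullSimplex (S.erase v)).faces.Nonempty := by
      refine ⟨S.erase v, Finset.card_pos.1 ?_, Finset.Subset.refl _⟩
      rw [Finset.card_erase_of_mem hvS]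
      omega
    have hfin : (fullSimplex (S.erase v)).faces.Finite :=
      (Finset.finite_toSet (S.erase v).powerset).subset fun s hs =>
        Finset.mem_coe.2 (Finset.mem_powerset.2 hs.2)
    have hv : {v} ∉ (fullSimplex (S.erase v)).faces := fun h =>
      Finset.notMem_erase v S (Finset.singleton_subset_iff.1 h.2)
    have hL := fullSimplex_eq_cone hvS
    exact ⟨morseIncl_nullhomotopic hK hfin hv _ hL,
      fun G k => morseIncl_segment hK hfin hv _ hL G k,
      fun G k => relativeHomology_morseIncl hK hfin hv _ hL G k⟩
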